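/- **Setting.** $G=(V,E)$ is a connected undirected simple graph on $n\ge 2$ vertices with edge weights in $\{1,\dots,W\}$ and average (unweighted) degree $d=\frac1n\sum_v\deg(v)$. For a minimum spanning tree of $G$ with edge weights $w_1\le\dots\le w_{n-1}$, the single-linkage clustering cost is $\mathrm{cost}(G)=\sum_{i=1}^{n-1}(n-i)\,w_i$. $G_j$ is the spanning subgraph of $G$ formed by the edges of weight at most $j$. **Access and cost.** The algorithms know $n$ and reach $G$ only through its adjacency lists: for every vertex a linked list of its neighbours (in arbitrary order), each with the weight of the edge. Reading one list cell is one query and takes unit time, and the first $i$ cells of a list must be read to reach its $i$-th neighbour. Sampling a uniform vertex, flipping a fair coin, and elementary operations (arithmetic, square roots, logarithms and rounding of real numbers, dictionary operations) take unit time. **Algorithm ACC$(j,\varepsilon,k,d)$** (estimate for the number of components of $G_j$). Let $r=\lceil 64k/\varepsilon^2\rceil$, $\Gamma=\lceil 4k/\varepsilon\rceil$, $D=d\,\Gamma$. Sample $r$ independent uniform vertices. For each sampled $u$, start a breadth first search of $G_j$ at $u$, which scans the $G$-adjacency lists of the vertices that it visits, by reading the whole list of $u$, of length $d_u$. If $u$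 is isolated in $G_j$, set $\beta=1$. Otherwise repeat: flip a coin; if it shows heads, fewer than $\Gamma$ vertices have been visited, and at most $D$ cells of each list have been read, resume the search until the number of cells read has doubled or the component of $u$ has been explored, else set $\beta=0$ and stop; if the component has been explored, set $\beta=d_u\,2^{\#\text{coin flips}}/\#\text{cells read}$ and stop. Return $\frac nr\sum\beta$. **Algorithm AppCost$_C(G,\varepsilon,W,d)$.** Let $t_1=\lfloor\log_{1+\varepsilon}\sqrt W+1\rfloor$, $t_2=\lfloor\frac1\varepsilon-1\rfloor$, $t=t_1+t_2+1$; $B_i=\frac{n}{(1+\varepsilon)^{i-1}}$ for $1\le i\le t_1$, $B_i=\frac{n}{\sqrt W}(1-\varepsilon(i-t_1))$ for $t_1<i\le t_1+t_2$, and $B_t=1$. For $j\in\{1,\dots,W\}$ let $\hat c_j=\min\{\max\{\hat c_j',1\},n\}$, where $\hat c'_j$ is the median of $\lceil C\log(1/\delta)\rceil$, $\delta=\frac1{4W}$, independent runs of ACC$(j,\varepsilon/8,\sqrt W,d)$; $\hat c_j$ is computed when it is first needed, and then stored and reused. For $i=1,\dots,t$ let $\hat j_i$ be the result of the binary search with key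 $B_i$: start with $\ell=1$, $r=W$; while $\ell<r$, let $m=\lfloor(\ell+r)/2\rfloor$ and set $r=m$ if $\hat c_m\le B_i$ and $\ell=m+1$ otherwise; return $\ell$. Output $$\widehat{\mathrm{cost}}(G)=\frac{n(n-1)}2+\frac12\sum_{i=1}^{t-1}(\hat j_{i+1}-\hat j_i)(B_i^2-B_i)$$ and $(\hat j_1,\dots,\hat j_t)$. **Theorem.** There is an absolute constant $C_0>0$ such that for every constant $C\ge C_0$ there is a constant $K>0$, depending only on $C$, with the following property. Let $G$ be as above with $\sqrt W\le n$, given by any adjacency lists, and let $0<\varepsilon<1$. Then AppCost$_C(G,\varepsilon/102,W,d)$ outputs, with probability at least $3/4$, a value with $$(1-\varepsilon)\,\mathrm{cost}(G)\le\widehat{\mathrm{cost}}(G)\le(1+\varepsilon)\,\mathrm{cost}(G),$$ and its expected number of queries and its expected running time are both at most $$K\cdot\frac{\sqrt W\,d}{\varepsilon^3}\,\log^4\!\Big(\frac{2Wd}{\varepsilon}\Big).$$ -/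

import Mathlib

noncomputable section

namespace SLC

open scoped ENNReal

/-! ### Weighted graphs, minimum spanning trees and the single-linkage cost -/

/-- An undirected graph on `n` vertices with integer edge weights in `{1, …, W}`. -/
structure WeightedGraph (n W : ℕ) where
  graph : SimpleGraph (Fin n)
  weight : Sym2 (Fin n) → ℕ
  one_le_weight : ∀ e ∈ graph.edgeSet, 1 ≤ weight e
  weight_le : ∀ e ∈ graph.edgeSet, weight e ≤ W

namespace WeightedGraph

variable {n W : ℕ}

open Classical in
/-- The average (unweighted) degree of the graph. -/
def avgDegree (G : WeightedGraph n W) : ℝ :=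
  (∑ v : Fin n, (G.graph.degree v : ℝ)) / n

open Classical in
/-- The multiset of the weights of the edges of `T`. -/
def edgeWeights (G : WeightedGraph n W) (T : SimpleGraph (Fin n)) : Multiset ℕ :=
  T.edgeFinset.val.map G.weight

/-- `T` is a minimum spanning tree of `G`. -/
def IsMST (G : WeightedGraph n W) (T : SimpleGraph (Fin n)) : Prop :=
  T ≤ G.graph ∧ T.IsTree ∧
    ∀ T' : SimpleGraph (Fin n), T' ≤ G.graph → T'.IsTree →
      (G.edgeWeights T).sum ≤ (G.edgeWeights T').sum

/-- The total single-linkage clustering cost `∑_{i=1}^{n-1} (n - i) w_i`, where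
`w_1 ≤ … ≤ w_{n-1}` are the sorted edge weights of the minimum spanning tree `T`. -/
def slcCost (G : WeightedGraph n W) (T : SimpleGraph (Fin n)) : ℕ :=
  ∑ i ∈ Finset.Icc 1 (n - 1), (n - i) * ((G.edgeWeights T).sort (· ≤ ·)).getD (i - 1) 0

/-- An adjacency list representation of `G`: the list of `v` contains every neighbour of `v`
exactly once, in an arbitrary order, together with the weight of the edge. -/
structure AdjLists (G : WeightedGraph n W) where
  list : Fin n → List (Fin n × ℕ)
  nodup : ∀ v, (list v).Nodup
  mem_iff : ∀ v u a, (u, a) ∈ list v ↔ G.graph.Adj v u ∧ a = G.weight s(v, u)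

end WeightedGraph

/-! ### Randomized programs with adjacency list query access

A program knows `n`, and reaches the graph only by reading cells of the (linked) adjacency
lists.  Reading a cell is one query and takes one unit of time; as a cell other than the first
one of a list is reached through the pointer stored in its predecessor, reaching the `i`-th
neighbour of a vertex takes `i` reads.  Sampling a vertex and flipping a coin take one
unit of time each.  All other computation (unit-cost random access machine with real numbers)
is charged for explicitly by `work`. -/

/-- A pointer to a cell of the adjacency list of `vertex`. -/
structure Pointer (n : ℕ) where
  vertex : Fin n
  pos : ℕ

/-- The pointer to the first cell of the list of `v`. -/
def Pointer.head {n : ℕ} (v : Fin n) : Pointer n := ⟨v, 0⟩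

/-- The content of a cell: a neighbour, the weight of the edge to it, and the pointer to the
next cell (`none` at the end of the list). -/
structure Cell (n : ℕ) where
  nbr : Fin n
  wt : ℕ
  next : Option (Pointer n)

/-- The cell that a pointer refers to (`none` only if there is no such cell). -/
def lookup {n : ℕ} (adj : Fin n → List (Fin n × ℕ)) (c : Pointer n) : Option (Cell n) :=
  (adj c.vertex)[c.pos]?.map fun e =>
    { nbr := e.1
      wt := e.2
      next := if c.pos + 1 < (adj c.vertex).length then some ⟨c.vertex, c.pos + 1⟩ else none }

inductive Prog (n : ℕ) (α : Type) : Type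
  | ret (a : α) : Prog n α
  | work (t : ℕ) (p : Prog n α) : Prog n α
  | sample (k : Fin n → Prog n α) : Prog n α
  | coin (k : Bool → Prog n α) : Prog n α
  | read (c : Pointer n) (k : Option (Cell n) → Prog n α) : Prog n α

namespace Prog

variable {n : ℕ} {α β σ : Type}

protected def bind : Prog n α → (α → Prog n β) → Prog n β
  | ret a, f => f a
  | work t p, f => work t (p.bind f)
  | sample k, f => sample fun v => (k v).bind f
  | coin k, f => coin fun b => (k b).bind f
  | read c k, f => read c fun e => (k e).bind f

instance : Monad (Prog n) where
  pure := Prog.ret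
  bind := Prog.bind

/-- The result of a run: the output, the number of queries and the running time. -/
structure Outcome (α : Type) where
  out : α
  queries : ℕ
  time : ℕ

def Outcome.charge (q t : ℕ) (x : Outcome α) : Outcome α :=
  ⟨x.out, x.queries + q, x.time + t⟩

/-- The distribution of the result of a run on given adjacency lists. -/
def run [NeZero n] (adj : Fin n → List (Fin n × ℕ)) : Prog n α → PMF (Outcome α)
  | ret a => PMF.pure ⟨a, 0, 0⟩
  | work t p => (run adj p).map (Outcome.charge 0 t)
  | sample k => (PMF.uniformOfFintype (Fin n)).bind fun v =>
      (run adj (k v)).map (Outcome.charge 0 1)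
  | coin k => (PMF.uniformOfFintype Bool).bind fun b =>
      (run adj (k b)).map (Outcome.charge 0 1)
  | read c k => (run adj (k (lookup adj c))).map (Outcome.charge 1 1)

/-- The probability that the output of `p` satisfies `P`. -/
def prob [NeZero n] (adj : Fin n → List (Fin n × ℕ)) (p : Prog n α) (P : α → Prop) : ℝ≥0∞ :=
  (run adj p).toOuterMeasure {x | P x.out}

/-- The expected number of queries. -/
def expectedQueries [NeZero n] (adj : Fin n → List (Fin n × ℕ)) (p : Prog n α) : ℝ≥0∞ :=
  ∑' x, run adj p x * (x.queries : ℝ≥0∞)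

/-- The expected running time. -/
def expectedTime [NeZero n] (adj : Fin n → List (Fin n × ℕ)) (p : Prog n α) : ℝ≥0∞ :=
  ∑' x, run adj p x * (x.time : ℝ≥0∞)

def doWork (t : ℕ) : Prog n Unit := work t (ret ())
def sampleVertex : Prog n (Fin n) := sample ret
def flipCoin : Prog n Bool := coin ret
def readCell (c : Pointer n) : Prog n (Option (Cell n)) := read c ret

/-- Execute `body` as long as the flag that it returns is `true`.  The cap `N` only makes the
definition structurally recursive; every use below has a cap that is never reached on simple
graphs with `n` vertices. -/
def loop : (N : ℕ) → (body : σ → Prog n (σ × Bool)) → σ → Prog n σ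
  | 0, _, s => pure s
  | N + 1, body, s => do
      let (s', go) ← body s
      if go then loop N body s' else pure s'

/-- The list of the outputs of `r` independent runs. -/
def replicate : (r : ℕ) → Prog n α → Prog n (List α)
  | 0, _ => pure []
  | r + 1, p => do
      doWork 1
      let a ← p
      let l ← replicate r p
      pure (a :: l)

end Prog

open Prog

variable {n : ℕ}

/-! ### Estimating the number of connected components

`G_j` is the subgraph of all edges of weight at most `j`. -/

/-- The state of a breadth first search.  `pending` is the queue: the rest of the list that is
being scanned (with the number of its cells read so far), followed by the lists of the
visited vertices that have not been scanned yet.  `edges` is the number of edges visited in `G`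
(cells read), and `maxRead` the largest number of cells read from one list. -/
structure BFS (n : ℕ) where
  visited : Finset (Fin n)
  pending : List (Pointer n × ℕ)
  edges : ℕ
  maxRead : ℕ

def BFS.init (u : Fin n) : BFS n := ⟨{u}, [(Pointer.head u, 0)], 0, 0⟩

/-- One step of the search on `G_j`: visit the next edge of `G`. -/
def bfsStep (j : ℕ) (s : BFS n) : Prog n (BFS n) := do
  doWork 1
  match s.pending with
  | [] => pure s
  | (c, i) :: q =>
    match ← readCell c with
    | none => pure { s with pending := q }
    | some e =>
      let q₁ : List (Pointer n × ℕ) :=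
        match e.next with
        | some c' => (c', i + 1) :: q
        | none => q
      let isNew : Prop := e.wt ≤ j ∧ e.nbr ∉ s.visited
      pure
        { visited := if isNew then insert e.nbr s.visited else s.visited
          pending := if isNew then q₁ ++ [(Pointer.head e.nbr, 0)] else q₁
          edges := s.edges + 1
          maxRead := max s.maxRead (i + 1) }

/-- The first step of the search from `u`: examine all edges of `G` that are incident to `u`. -/
def bfsFirst (j : ℕ) (u : Fin n) : Prog n (BFS n) :=
  loop (n ^ 2 + 1)
    (fun s => do
      let s' ← bfsStep j s
      pure (s', decide (s'.pending.head?.map (fun x => x.1.vertex) = some u)))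
    (BFS.init u)

/-- Resume the search until it has visited `budget` edges or the whole component. -/
def bfsResume (j budget : ℕ) (s : BFS n) : Prog n (BFS n) :=
  loop (n ^ 2 + 1)
    (fun s => do
      let s' ← bfsStep j s
      pure (s', decide (s'.pending ≠ [] ∧ s'.edges < budget)))
    s

/-- The variable `β` for the sampled vertex `u`, with vertex threshold `Γ` and degree threshold
`D`.  In the loop, `p` is `2` to the number of coin flips. -/
def sampleBeta (j Γ : ℕ) (D : ℝ) (u : Fin n) : Prog n ℝ := do
  let s₀ ← bfsFirst j u
  doWork 1
  if s₀.pending = [] then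
    pure 1
  else
    let res ← loop (n ^ 2 + 1)
      (fun x : BFS n × ℕ × ℝ => do
        let (s, p, _) := x
        doWork 1
        let heads ← flipCoin
        if heads = true ∧ s.visited.card < Γ ∧ (s.maxRead : ℝ) ≤ D then
          let s' ← bfsResume j (2 * s.edges) s
          if s'.pending = [] then
            pure ((s', 2 * p, (s₀.edges : ℝ) * ((2 * p : ℕ) : ℝ) / (s'.edges : ℝ)), false)
          else
            pure ((s', 2 * p, 0), true)
        else
          pure ((s, 2 * p, 0), false))
      (s₀, 1, 0)
    pure res.2.2

/-- `ApproximateConnectedComponents` for the subgraph `H = G_j`. -/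
def approxCC (j : ℕ) (ε k d : ℝ) : Prog n ℝ := do
  let r : ℕ := ⌈64 * k / ε ^ 2⌉₊
  let Γ : ℕ := ⌈4 * k / ε⌉₊
  doWork 1
  let βs ← replicate r do
    let u ← sampleVertex
    sampleBeta j Γ (d * Γ) u
  pure ((n : ℝ) / r * βs.sum)

/-- The median of a list. -/
def median (l : List ℝ) : ℝ := (l.insertionSort (· ≤ ·)).getD (l.length / 2) 0

/-- `AppNCCMedianTrick`: the median of `C log (1 / δ)` independent runs. -/
def appNCCMedian (C : ℝ) (j : ℕ) (ε k d δ : ℝ) : Prog n ℝ := do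
  let m : ℕ := ⌈C * Real.log (1 / δ)⌉₊
  let l ← replicate m (approxCC j ε k d)
  doWork (m ^ 2 + 1)
  pure (median l)

/-! ### Binary search on the estimates -/

/-- The estimates computed so far. -/
abbrev Table := ℕ → Option ℝ

/-- The `m`-th estimate: the stored value if there is one, otherwise a new one, which is
stored. -/
def getEst (est : ℕ → Prog n ℝ) (m : ℕ) (T : Table) : Prog n (ℝ × Table) := do
  doWork 1
  match T m with
  | some x => pure (x, T)
  | none => do
      let x ← est m
      pure (x, Function.update T m (some x))

def binarySearch (est : ℕ → Prog n ℝ) (B : ℝ) (l r : ℕ) (T : Table) : Prog n (ℕ × Table) :=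
  if _h : l < r then do
    let (x, T') ← getEst est ((l + r) / 2) T
    if x ≤ B then binarySearch est B l ((l + r) / 2) T'
    else binarySearch est B ((l + r) / 2 + 1) r T'
  else pure (l, T)
termination_by r - l
decreasing_by all_goals omega

/-- The binary searches on `{1, …, W}` for the given keys, with a common table. -/
def searchAll (est : ℕ → Prog n ℝ) (W : ℕ) : List ℝ → Table → Prog n (List ℕ)
  | [], _ => pure []
  | B :: Bs, T => do
      doWork 1
      let (i, T') ← binarySearch est B 1 W T
      let is ← searchAll est W Bs T'
      pure (i :: is)

/-! ### Interval endpoints and the main algorithm -/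

def t₁ (W : ℕ) (ε : ℝ) : ℕ := ⌊Real.logb (1 + ε) (√W) + 1⌋₊

def t₂ (ε : ℝ) : ℕ := ⌊1 / ε - 1⌋₊

/-- The interval endpoints `B_1, …, B_t`, where `t = t₁ + t₂ + 1`. -/
def endpoint (n W : ℕ) (ε : ℝ) (i : ℕ) : ℝ :=
  if i ≤ t₁ W ε then n / (1 + ε) ^ (i - 1)
  else if i ≤ t₁ W ε + t₂ ε then n / √W * (1 - ε * ((i : ℝ) - t₁ W ε))
  else 1

/-- The estimate of the number of connected components of `G_j`, clamped to `[1, n]`. -/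
def componentEstimate (C : ℝ) (W : ℕ) (d ε : ℝ) (j : ℕ) : Prog n ℝ := do
  let c ← appNCCMedian C j (ε / 8) (√W) d (1 / (4 * W))
  doWork 1
  pure (min (max c 1) n)

/-- `AppCost`, with accuracy parameter `ε`, maximum weight `W` and average degree `d`; `C` is the
constant in the number of repetitions of the median trick.  The output consists of
the estimate of the cost and of the indices found by the binary searches.  The `3 t + 1`
units of work pay for `t₁` and `t₂`, for the endpoints, each of which is obtained
from the preceding one, and for the final sum. -/
def appCost (C : ℝ) (W : ℕ) (d ε : ℝ) : Prog n (ℝ × List ℕ) := do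
  let t : ℕ := t₁ W ε + t₂ ε + 1
  doWork (3 * t + 1)
  let js ← searchAll (componentEstimate C W d ε) W
    ((List.range t).map fun i => endpoint n W ε (i + 1)) (fun _ => none)
  let index : ℕ → ℝ := fun i => ((js.getD (i - 1) 0 : ℕ) : ℝ)
  let cost : ℝ := (n : ℝ) * (n - 1) / 2 + 1 / 2 * ∑ i ∈ Finset.Icc 1 (t - 1),
    (index (i + 1) - index i) * (endpoint n W ε i ^ 2 - endpoint n W ε i)
  pure (cost, js)

end SLC

end

noncomputable section

namespace SLC

open scoped ENNReal

/-! ### Expectations over the runs of a program -/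

namespace Prog

variable {n : ℕ} {α β σ : Type}

/-! Let c_j be the number of components of G_j. By an exchange argument (`IsMST.reachable_below`)
the edges of weight at most j of a minimum spanning tree connect the same vertices as all edges of
weight at most j, so exactly c_j - 1 tree edges are heavier than j. Writing each w_i as the number
of integers j ≥ 0 below it turns the cost into half the sum of c_j² - c_j over 0 ≤ j < W
(`IsMST.slcCost_eq`); the term j = 0 is n(n-1)/2.

Put x = n/√W. An error of e · max(c_j, x) in c_j is harmless: the relative part changes the sum by
O(e · cost), and the additive part by O(e W x²) = O(e n²), which is again O(e · cost) because the
term j = 0 is of order n². For the same reason c_j may be replaced by an endpoint B_i between two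
consecutive search results (`abs_estimate_sub_le`). The estimates need not be monotone in j. It
suffices that a binary search stops where the estimates cross the key (`detSearch_spec`) and that a
smaller key never gives an earlier stop (`detSearch_antitone`); the monotonicity of the true c_j
does the rest.

For the estimates, a vertex u of degree d_u in a component of total degree m receives the share
d_u/m, and the shares of each component add up to 1. As the search doubles, the probability of
reaching the next stage halves while the potential value of β doubles, so β has mean d_u/m unless
the search is cut off. The thresholds spoil at most 2n/Γ components (`le_sum_ev_sampleBeta`). Since
β ≤ 2, the second moment is small, and Chebyshev's inequality gives success probability 7/8
(`ev_approxCC_le`). The median raises it to 1 - 1/(4W) (`ev_componentEstimate_le`), and a union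
bound over the fewer than W table entries leaves failure probability at most 1/4
(`ev_searchAll_le`).

The same halving and doubling makes every stage of a search from u cost O(d_u) in expectation. There
are O(log(Γ D)) stages, and d_u averages to d over the random u. Multiplying by the numbers of
samples, repetitions, search steps and keys gives the time bound; queries are dominated by time.

All of this is computed with the functional `ev`, defined by recursion on programs: τ = 0 gives
expectations of outputs, τ = 1 expected times. `tsum_run_mul` ties it to the distribution `run`. -/

/-- The expectation of `τ · time + f out`. -/
def ev (adj : Fin n → List (Fin n × ℕ)) (τ : ℝ) : Prog n α → (α → ℝ) → ℝ
  | ret a, f => f a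
  | work t p, f => τ * t + ev adj τ p f
  | sample k, f => τ + (∑ v, ev adj τ (k v) f) / n
  | coin k, f => τ + (ev adj τ (k true) f + ev adj τ (k false) f) / 2
  | read c k, f => τ + ev adj τ (k (lookup adj c)) f

variable {adj : Fin n → List (Fin n × ℕ)} {τ : ℝ}

@[simp] lemma ev_pure (a : α) (f : α → ℝ) : ev adj τ (pure a) f = f a := rfl

@[simp] lemma ev_doWork (t : ℕ) (f : Unit → ℝ) : ev adj τ (doWork t) f = τ * t + f () := rfl

@[simp] lemma ev_sampleVertex (f : Fin n → ℝ) :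
    ev adj τ sampleVertex f = τ + (∑ v, f v) / n := rfl

@[simp] lemma ev_flipCoin (f : Bool → ℝ) :
    ev adj τ flipCoin f = τ + (f true + f false) / 2 := rfl

@[simp] lemma ev_readCell (c : Pointer n) (f : Option (Cell n) → ℝ) :
    ev adj τ (readCell c) f = τ + f (lookup adj c) := rfl

-- The tower property. It makes `ev` compositional, so that every algorithm below is analysed by
-- rewriting through its `do` block.
@[simp] lemma ev_bind (p : Prog n α) (k : α → Prog n β) (f : β → ℝ) :
    ev adj τ (p >>= k) f = ev adj τ p fun a => ev adj τ (k a) f := by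
  change ev adj τ (p.bind k) f = _
  induction p with
  | ret a => rfl
  | work t p ih => simp only [Prog.bind, ev, ih]
  | sample k ih => simp only [Prog.bind, ev, ih]
  | coin k ih => simp only [Prog.bind, ev, ih]
  | read c k ih => simp only [Prog.bind, ev, ih]

lemma ev_mono (p : Prog n α) {f g : α → ℝ} (h : ∀ a, f a ≤ g a) :
    ev adj τ p f ≤ ev adj τ p g := by
  induction p with
  | ret a => exact h a
  | work t p ih => simp only [ev]; linarith
  | sample k ih =>
    simp only [ev]
    gcongr with v
    exact ih v
  | coin k ih => simp only [ev]; linarith [ih true, ih false]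
  | read c k ih => simp only [ev]; linarith [ih (lookup adj c)]

/-- Linearity is special to τ = 0: otherwise the time term would be counted twice on the right. -/
lemma ev_zero_add (p : Prog n α) (f g : α → ℝ) :
    ev adj 0 p (fun a => f a + g a) = ev adj 0 p f + ev adj 0 p g := by
  induction p with
  | ret a => rfl
  | work t p ih => simp only [ev, ih]; ring
  | sample k ih => simp only [ev, ih, Finset.sum_add_distrib]; ring
  | coin k ih => simp only [ev, ih]; ring
  | read c k ih => simp only [ev, ih]; ring

lemma ev_zero_mul (p : Prog n α) (f : α → ℝ) (b : ℝ) :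
    ev adj 0 p (fun a => b * f a) = b * ev adj 0 p f := by
  induction p with
  | ret a => rfl
  | work t p ih => simp only [ev, ih]; ring
  | sample k ih => simp only [ev, ih, ← Finset.mul_sum]; ring
  | coin k ih => simp only [ev, ih]; ring
  | read c k ih => simp only [ev, ih]; ring

lemma ev_nonneg (hτ : 0 ≤ τ) (p : Prog n α) {f : α → ℝ} (hf : ∀ a, 0 ≤ f a) :
    0 ≤ ev adj τ p f := by
  induction p with
  | ret a => exact hf a
  | work t p ih => simp only [ev]; positivity
  | sample k ih =>
    simp only [ev]
    have := Finset.sum_nonneg fun v (_ : v ∈ Finset.univ) => ih v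
    positivity
  | coin k ih => simp only [ev]; linarith [ih true, ih false]
  | read c k ih => simp only [ev]; linarith [ih (lookup adj c)]

section NeZero

variable [NeZero n]

lemma ev_add_const (p : Prog n α) (f : α → ℝ) (b : ℝ) :
    ev adj τ p (fun a => f a + b) = ev adj τ p f + b := by
  have hn : (n : ℝ) ≠ 0 := NeZero.ne _
  induction p with
  | ret a => rfl
  | work t p ih => simp only [ev, ih]; ring
  | sample k ih =>
    simp only [ev, ih, Finset.sum_add_distrib, Finset.sum_const, Finset.card_univ,
      Fintype.card_fin, nsmul_eq_mul]
    field_simp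
    ring
  | coin k ih => simp only [ev, ih]; ring
  | read c k ih => simp only [ev, ih]; ring

lemma ev_zero_const (p : Prog n α) (b : ℝ) : ev adj 0 p (fun _ => b) = b := by
  have h0 : ev adj 0 p (fun _ => (0 : ℝ)) = 0 := by
    induction p with
    | ret a => rfl
    | work t p ih => simp [ev, ih]
    | sample k ih => simp [ev, ih]
    | coin k ih => simp [ev, ih]
    | read c k ih => simp [ev, ih]
  have := ev_add_const (adj := adj) (τ := 0) p (fun _ => (0 : ℝ)) b
  simpa [h0] using this

/-- The expected time, with a bound on the remaining cost. -/
lemma ev_le_add (p : Prog n α) {f : α → ℝ} {b : ℝ} (hf : ∀ a, f a ≤ b) :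
    ev adj τ p f ≤ ev adj τ p (fun _ => 0) + b := by
  rw [← ev_add_const]
  exact ev_mono p fun a => by linarith [hf a]

/-! ### The connection with the distribution of outcomes -/

lemma tsum_bind_mul {γ δ : Type} (μ : PMF γ) (k : γ → PMF δ) (F : δ → ℝ≥0∞) :
    ∑' y, (μ.bind k) y * F y = ∑' x, μ x * ∑' y, k x y * F y := by
  simp only [PMF.bind_apply, ← ENNReal.tsum_mul_right, ← ENNReal.tsum_mul_left]
  rw [ENNReal.tsum_comm]
  simp only [mul_assoc]

lemma tsum_pure_mul {γ : Type} (a : γ) (F : γ → ℝ≥0∞) :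
    ∑' y, (PMF.pure a) y * F y = F a := by
  rw [tsum_eq_single a]
  · simp
  · intro b hb
    simp [PMF.pure_apply, hb]

lemma tsum_map_mul {γ δ : Type} (μ : PMF γ) (g : γ → δ) (F : δ → ℝ≥0∞) :
    ∑' y, (μ.map g) y * F y = ∑' x, μ x * F (g x) := by
  rw [← PMF.bind_pure_comp, tsum_bind_mul]
  simp only [Function.comp_apply, tsum_pure_mul]

/-- Induction on the program. The charge of the leading instruction is moved from the outcome into
the payoff, which is why `f` is generalized. Nonnegativity is needed because `ENNReal.ofReal`
truncates. -/
lemma tsum_run_mul (hτ : 0 ≤ τ) (p : Prog n α) {f : α → ℝ} (hf : ∀ a, 0 ≤ f a) :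
    ∑' x, run adj p x * ENNReal.ofReal (τ * x.time + f x.out)
      = ENNReal.ofReal (ev adj τ p f) := by
  have hn : (n : ℝ) ≠ 0 := NeZero.ne _
  have key : ∀ (q t : ℕ) (p : Prog n α) (f : α → ℝ),
      ∑' x, (run adj p).map (Outcome.charge q t) x * ENNReal.ofReal (τ * x.time + f x.out)
        = ∑' x, run adj p x * ENNReal.ofReal (τ * x.time + (f x.out + τ * t)) := by
    intro q t p f
    rw [tsum_map_mul]
    refine tsum_congr fun x => ?_
    congr 2
    simp only [Outcome.charge]
    push_cast
    ring
  induction p generalizing f with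
  | ret a => simp [run, ev]
  | work t p ih =>
    have h1 : ∀ a, 0 ≤ f a + τ * t := fun a => by have := hf a; positivity
    simp only [run, key]
    rw [ih h1, ev_add_const, ev]
    ring_nf
  | read c k ih =>
    have h1 : ∀ a, 0 ≤ f a + τ * (1 : ℕ) := fun a => by have := hf a; positivity
    simp only [run, key]
    rw [ih _ h1, ev_add_const, ev]
    simp [add_comm]
  | sample k ih =>
    have h1 : ∀ a, 0 ≤ f a + τ * (1 : ℕ) := fun a => by have := hf a; positivity
    simp only [run, tsum_bind_mul, key, ev]
    simp only [ih _ h1, tsum_fintype, PMF.uniformOfFintype_apply, Fintype.card_fin]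
    have h2 : ∀ v, 0 ≤ ev adj τ (k v) f := fun v => ev_nonneg hτ _ hf
    rw [← Finset.mul_sum, ← ENNReal.ofReal_sum_of_nonneg (fun v _ => ev_nonneg hτ _ h1)]
    have h3 : ((n : ℝ≥0∞))⁻¹ = ENNReal.ofReal ((n : ℝ)⁻¹) := by
      rw [ENNReal.ofReal_inv_of_pos (by positivity), ENNReal.ofReal_natCast]
    rw [h3, ← ENNReal.ofReal_mul (by positivity)]
    simp only [ev_add_const, Finset.sum_add_distrib, Finset.sum_const, Finset.card_univ,
      Fintype.card_fin, nsmul_eq_mul]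
    congr 1
    field_simp
    push_cast
    ring
  | coin k ih =>
    have h1 : ∀ a, 0 ≤ f a + τ * (1 : ℕ) := fun a => by have := hf a; positivity
    simp only [run, tsum_bind_mul, key, ev]
    simp only [ih _ h1, tsum_fintype, PMF.uniformOfFintype_apply, Fintype.card_bool,
      Fintype.sum_bool]
    have h3 : ((2 : ℕ) : ℝ≥0∞)⁻¹ = ENNReal.ofReal ((2 : ℝ)⁻¹) := by
      rw [ENNReal.ofReal_inv_of_pos (by positivity)]
      simp
    rw [h3, ← mul_add, ← ENNReal.ofReal_add (ev_nonneg hτ _ h1) (ev_nonneg hτ _ h1),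
      ← ENNReal.ofReal_mul (by positivity)]
    simp only [ev_add_const]
    congr 1
    push_cast
    ring

lemma expectedTime_eq (p : Prog n α) :
    expectedTime adj p = ENNReal.ofReal (ev adj 1 p fun _ => 0) := by
  rw [expectedTime, ← tsum_run_mul zero_le_one p (fun _ => le_rfl)]
  simp

lemma prob_eq (p : Prog n α) (P : α → Prop) [DecidablePred P] :
    prob adj p P = ENNReal.ofReal (ev adj 0 p fun a => if P a then 1 else 0) := by
  rw [prob, ← tsum_run_mul le_rfl p (fun a => by split_ifs <;> norm_num),
    PMF.toOuterMeasure_apply]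
  refine tsum_congr fun x => ?_
  by_cases h : P x.out <;> simp [Set.indicator, h]

lemma queries_le_time (p : Prog n α) : ∀ x ∈ (run adj p).support, x.queries ≤ x.time := by
  induction p with
  | ret a => simp [run]
  | work t p ih =>
    intro x hx
    obtain ⟨y, hy, rfl⟩ := (PMF.mem_support_map_iff _ _ _).1 hx
    have := ih y hy
    simp only [Outcome.charge]
    omega
  | sample k ih =>
    intro x hx
    obtain ⟨v, -, hv⟩ := (PMF.mem_support_bind_iff _ _ _).1 hx
    obtain ⟨y, hy, rfl⟩ := (PMF.mem_support_map_iff _ _ _).1 hv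
    have := ih v y hy
    simp only [Outcome.charge]
    omega
  | coin k ih =>
    intro x hx
    obtain ⟨v, -, hv⟩ := (PMF.mem_support_bind_iff _ _ _).1 hx
    obtain ⟨y, hy, rfl⟩ := (PMF.mem_support_map_iff _ _ _).1 hv
    have := ih v y hy
    simp only [Outcome.charge]
    omega
  | read c k ih =>
    intro x hx
    obtain ⟨y, hy, rfl⟩ := (PMF.mem_support_map_iff _ _ _).1 hx
    have := ih _ y hy
    simp only [Outcome.charge]
    omega

lemma expectedQueries_le_expectedTime (p : Prog n α) :
    expectedQueries adj p ≤ expectedTime adj p := by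
  refine ENNReal.tsum_le_tsum fun x => ?_
  by_cases hx : x ∈ (run adj p).support
  · gcongr
    exact queries_le_time p x hx
  · rw [PMF.mem_support_iff, not_not] at hx
    simp [hx]

end NeZero

/-! ### Independent repetitions -/

section Replicate

variable [NeZero n]

lemma ev_replicate_time_le (r : ℕ) (p : Prog n α) {b : ℝ}
    (hb : ev adj 1 p (fun _ => 0) ≤ b) :
    ev adj 1 (replicate r p) (fun _ => 0) ≤ r * (1 + b) := by
  induction r with
  | zero => simp [replicate]
  | succ r ih =>
    simp only [replicate, ev_bind, ev_doWork, ev_pure]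
    have := ev_le_add (adj := adj) (τ := 1) p (f := fun _ => ev adj 1 (replicate r p) fun _ => 0)
      (fun _ => ih)
    push_cast
    linarith

/-- The second moment of a sum of independent copies around its mean. -/
lemma ev_replicate_sum_sq (r : ℕ) (p : Prog n ℝ) {μ v : ℝ} (hμ : ev adj 0 p id = μ)
    (hv : ev adj 0 p (fun x => x ^ 2) ≤ v) (b : ℝ) :
    ev adj 0 (replicate r p) (fun l => (l.sum - r * μ + b) ^ 2) ≤ b ^ 2 + r * v := by
  induction r generalizing b with
  | zero => simp [replicate]
  | succ r ih =>
    simp only [replicate, ev_bind, ev_doWork, ev_pure, zero_mul, zero_add, List.sum_cons]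
    -- The first sample a turns the offset b into b + a - μ, whose square has mean b² + E a² - μ² ≤
    -- b² + v. The offset in the statement exists for this induction.
    have h1 : ∀ a : ℝ, ev adj 0 (replicate r p)
        (fun l => (a + l.sum - ((r + 1 : ℕ) : ℝ) * μ + b) ^ 2)
          ≤ a ^ 2 + (2 * (b - μ) * a + ((b - μ) ^ 2 + r * v)) := by
      intro a
      refine le_trans (le_of_eq ?_) ((ih (b + a - μ)).trans (le_of_eq ?_))
      · congr 1
        funext l
        push_cast
        ring
      · ring
    refine (ev_mono p h1).trans ?_
    rw [ev_zero_add, ev_add_const, ev_zero_mul]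
    change _ + (2 * (b - μ) * ev adj 0 p id + _) ≤ _
    rw [hμ]
    push_cast
    nlinarith [sq_nonneg μ]

omit [NeZero n] in
-- Independence of the runs. It supplies the exponential moment in the analysis of the median.
lemma ev_replicate_prod (r : ℕ) (p : Prog n α) (g : α → ℝ) :
    ev adj 0 (replicate r p) (fun l => (l.map g).prod) = ev adj 0 p g ^ r := by
  induction r with
  | zero => simp [replicate]
  | succ r ih =>
    simp only [replicate, ev_bind, ev_doWork, ev_pure, zero_mul, zero_add, List.map_cons,
      List.prod_cons, ev_zero_mul, ih]
    simp only [mul_comm (g _), ev_zero_mul]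
    ring

end Replicate

end Prog

open Finset

/-! ### Spanning forests and minimum spanning trees -/

section Forest

variable {V : Type*} [Fintype V]

lemma degree_toSimpleGraph {V : Type*} {F : SimpleGraph V} (c : F.ConnectedComponent) (v : c)
    [Fintype (F.neighborSet v)] [Fintype (c.toSimpleGraph.neighborSet v)] :
    F.degree v = c.toSimpleGraph.degree v := by
  symm
  refine Finset.card_bij (fun w _ => (w : V)) ?_ (fun _ _ _ _ h => Subtype.ext h) ?_
  · intro w hw
    rw [SimpleGraph.mem_neighborFinset] at hw ⊢
    exact hw
  · intro w hw
    rw [SimpleGraph.mem_neighborFinset] at hw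
    have hwc : w ∈ c.supp := by
      rw [SimpleGraph.ConnectedComponent.mem_supp_iff, ← v.2]
      exact SimpleGraph.ConnectedComponent.sound (SimpleGraph.Adj.reachable hw).symm
    refine ⟨⟨w, hwc⟩, ?_, rfl⟩
    rw [SimpleGraph.mem_neighborFinset]
    exact hw

open Classical in
/-- The number of components and the number of edges of a forest add up to the number of
vertices. -/
lemma isAcyclic_card_connectedComponent_add_card_edgeFinset {F : SimpleGraph V}
    (hF : F.IsAcyclic) :
    Nat.card F.ConnectedComponent + #F.edgeFinset = Fintype.card V := by
  -- Each component of a forest is a tree with one edge less than vertices; the handshake lemma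
  -- turns this into a degree sum, and degree sums add up over components.
  have hdeg : ∀ c : F.ConnectedComponent,
      ∑ v : V with F.connectedComponentMk v = c, F.degree v + 2
        = 2 * #{v : V | F.connectedComponentMk v = c} := by
    intro c
    have hT := hF.isTree_connectedComponent c
    have h1 := hT.card_edgeFinset
    have h2 := c.toSimpleGraph.sum_degrees_eq_twice_card_edges
    have h3 : ∑ v : V with F.connectedComponentMk v = c, F.degree v
        = ∑ v : c, c.toSimpleGraph.degree v := by
      rw [Finset.sum_subtype (p := fun v => v ∈ c.supp) _ (by simp)]
      exact Finset.sum_congr rfl fun v _ => degree_toSimpleGraph c v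
    have h4 : Nat.card c = #{v : V | F.connectedComponentMk v = c} :=
      Nat.subtype_card (p := fun v => v ∈ c) _ fun x => by
        rw [mem_filter, and_iff_right (mem_univ x)]
        exact (SimpleGraph.ConnectedComponent.mem_supp_iff c x).symm
    rw [Nat.card_eq_fintype_card] at h4
    omega
  have h1 := F.sum_degrees_eq_twice_card_edges
  have h2 : ∑ c : F.ConnectedComponent, (∑ v : V with F.connectedComponentMk v = c, F.degree v + 2)
      = ∑ c : F.ConnectedComponent, 2 * #{v : V | F.connectedComponentMk v = c} :=
    Finset.sum_congr rfl fun c _ => hdeg c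
  have h3 : ∑ c, ∑ v : V with F.connectedComponentMk v = c, F.degree v = ∑ v, F.degree v := by
    convert Finset.sum_fiberwise univ F.connectedComponentMk fun v => F.degree v
  have h4 : #(univ : Finset V) = ∑ c, #{v : V | F.connectedComponentMk v = c} := by
    convert Finset.card_eq_sum_card_fiberwise (t := univ) (f := F.connectedComponentMk)
      (s := univ) (by simp)
  rw [Finset.sum_add_distrib, h3, ← Finset.mul_sum, ← h4, h1] at h2
  simp only [sum_const, card_univ, smul_eq_mul] at h2
  rw [Nat.card_eq_fintype_card]
  omega

end Forest

/-! ### Components below a weight threshold and the cost formula -/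

namespace WeightedGraph

variable {n W : ℕ}

/-- The subgraph of `H` formed by the edges of weight at most `j`. -/
def below (G : WeightedGraph n W) (H : SimpleGraph (Fin n)) (j : ℕ) : SimpleGraph (Fin n) where
  Adj u v := H.Adj u v ∧ G.weight s(u, v) ≤ j
  symm := ⟨fun u v h => ⟨h.1.symm, by rw [Sym2.eq_swap]; exact h.2⟩⟩
  loopless := ⟨fun u h => H.loopless.irrefl u h.1⟩

lemma below_le (G : WeightedGraph n W) (H : SimpleGraph (Fin n)) (j : ℕ) : G.below H j ≤ H :=
  fun _ _ h => h.1

/-- The number of connected components of the subgraph of the edges of weight at most `j`. -/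
def numComponents (G : WeightedGraph n W) (j : ℕ) : ℕ :=
  Nat.card (G.below G.graph j).ConnectedComponent

lemma numComponents_antitone (G : WeightedGraph n W) : Antitone G.numComponents := by
  intro i j hij
  exact SimpleGraph.ConnectedComponent.card_le_card_of_le fun u v h => ⟨h.1, h.2.trans hij⟩

lemma numComponents_zero (G : WeightedGraph n W) : G.numComponents 0 = n := by
  have : G.below G.graph 0 = ⊥ := by
    ext u v
    simp only [below, SimpleGraph.bot_adj, iff_false, not_and, nonpos_iff_eq_zero]
    intro h
    have := G.one_le_weight s(u, v) h
    omega
  have h := isAcyclic_card_connectedComponent_add_card_edgeFinset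
    (SimpleGraph.isAcyclic_bot (V := Fin n))
  rw [numComponents, this]
  have h0 : ∀ i : Fintype (⊥ : SimpleGraph (Fin n)).edgeSet,
      #(@SimpleGraph.edgeFinset _ ⊥ i) = 0 := fun i => by
    rw [card_eq_zero, SimpleGraph.edgeFinset_eq_empty]
  rw [h0] at h
  simpa using h

lemma numComponents_le (G : WeightedGraph n W) (j : ℕ) : G.numComponents j ≤ n :=
  (G.numComponents_antitone (Nat.zero_le j)).trans_eq G.numComponents_zero

lemma one_le_numComponents [NeZero n] (G : WeightedGraph n W) (j : ℕ) :
    1 ≤ G.numComponents j := by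
  have : Nonempty (G.below G.graph j).ConnectedComponent :=
    ⟨(G.below G.graph j).connectedComponentMk 0⟩
  exact Nat.card_pos

open Classical in
/-- A minimum spanning tree has the same components as the graph below every threshold. -/
lemma IsMST.reachable_below {G : WeightedGraph n W} {T : SimpleGraph (Fin n)} (hT : G.IsMST T)
    {j : ℕ} {u v : Fin n} (huv : (G.below G.graph j).Adj u v) :
    (G.below T j).Reachable u v := by
  by_contra hn
  obtain ⟨hTG, htree, hmin⟩ := hT
  have hne : u ≠ v := huv.1.ne
  have huvT : ¬ T.Adj u v := fun h => hn (SimpleGraph.Adj.reachable ⟨h, huv.2⟩)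
  -- Exchange: the light tree edges together with uv form a forest, which extends to a spanning tree
  -- T' inside T + uv. T' arises from T by trading some edge e for uv, and e is heavier than j
  -- because T' keeps all light edges of T; so T' is lighter than T.
  have hac : (G.below T j ⊔ SimpleGraph.edge u v).IsAcyclic :=
    SimpleGraph.IsAcyclic.sup_edge_of_not_reachable hn (htree.isAcyclic.anti (G.below_le T j))
  have hconn : (T ⊔ SimpleGraph.edge u v).Connected := htree.connected.mono le_sup_left
  obtain ⟨T', hF, hT', htree'⟩ := hconn.exists_isTree_le_of_le_of_isAcyclic
    (sup_le_sup_right (G.below_le T j) _) hac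
  have huvT' : T'.Adj u v := hF (Or.inr (by simp [SimpleGraph.edge_adj, hne]))
  have hT'G : T' ≤ G.graph := by
    refine hT'.trans (sup_le hTG ?_)
    rw [SimpleGraph.edge_le_iff]
    exact Or.inr huv.1
  have hcard := htree.card_edgeFinset
  have hcard' := htree'.card_edgeFinset
  set A := T'.edgeFinset.erase s(u, v) with hA
  have hAT : A ⊆ T.edgeFinset := by
    intro e he
    rw [hA, mem_erase, SimpleGraph.mem_edgeFinset] at he
    have := SimpleGraph.edgeSet_mono hT' he.2
    rw [SimpleGraph.edgeSet_sup, SimpleGraph.edgeSet_edge_of_ne hne] at this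
    rw [SimpleGraph.mem_edgeFinset]
    exact this.resolve_right he.1
  have huvmem : s(u, v) ∈ T'.edgeFinset := by simpa using huvT'
  have hcardA : #A + 1 = #T'.edgeFinset := card_erase_add_one huvmem
  have hsd : #(T.edgeFinset \ A) = 1 := by
    rw [card_sdiff_of_subset hAT]
    omega
  obtain ⟨e, he⟩ := card_eq_one.1 hsd
  have heT : e ∈ T.edgeFinset ∧ e ∉ A := by
    rw [← mem_sdiff, he]
    simp
  have hew : j < G.weight e := by
    by_contra hle
    push Not at hle
    refine heT.2 ?_
    have h1 : e ∈ T.edgeSet := by simpa using heT.1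
    have h2 : e ∈ (G.below T j).edgeSet := by
      induction e with | _ a b => exact ⟨h1, hle⟩
    have h3 : e ∈ T'.edgeSet := SimpleGraph.edgeSet_mono (le_sup_left.trans hF) h2
    rw [hA, mem_erase, SimpleGraph.mem_edgeFinset]
    refine ⟨?_, h3⟩
    rintro rfl
    exact huvT h1
  have hle := hmin T' hT'G htree'
  have hs1 : (G.edgeWeights T).sum = ∑ x ∈ A, G.weight x + G.weight e := by
    have := sum_sdiff (f := G.weight) hAT
    rw [he, sum_singleton, add_comm] at this
    exact this.symm
  have hs2 : (G.edgeWeights T').sum = ∑ x ∈ A, G.weight x + G.weight s(u, v) :=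
    (sum_erase_add _ _ huvmem).symm
  have := huv.2
  omega

/-- The inclusion of the light part of T into that of G is onto on components because both contain
all vertices. It is injective because each edge of a walk in G can be replaced by a light path in T.
-/
lemma IsMST.card_connectedComponent {G : WeightedGraph n W} {T : SimpleGraph (Fin n)}
    (hT : G.IsMST T) (j : ℕ) :
    Nat.card (G.below T j).ConnectedComponent = G.numComponents j := by
  have hle : G.below T j ≤ G.below G.graph j := fun u v h => ⟨hT.1 h.1, h.2⟩
  refine Nat.card_congr (Equiv.ofBijective (SimpleGraph.ConnectedComponent.map
    (SimpleGraph.Hom.ofLE hle)) ⟨?_, SimpleGraph.ConnectedComponent.surjective_map_ofLE hle⟩)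
  intro c c'
  refine SimpleGraph.ConnectedComponent.ind₂ (fun u v h => ?_) c c'
  have h1 : (G.below G.graph j).Reachable u v := SimpleGraph.ConnectedComponent.exact h
  refine SimpleGraph.ConnectedComponent.sound ?_
  obtain ⟨p⟩ := h1
  induction p with
  | nil => exact SimpleGraph.Reachable.rfl
  | cons hadj p ih =>
    exact (hT.reachable_below hadj).trans (ih (SimpleGraph.ConnectedComponent.sound ⟨p⟩))

open Classical in
-- The light part of T is a forest with c_j components, hence n - c_j edges; of the n - 1 tree
-- edges, c_j - 1 remain.
lemma IsMST.countP_edgeWeights {G : WeightedGraph n W} {T : SimpleGraph (Fin n)}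
    (hT : G.IsMST T) (j : ℕ) :
    (G.edgeWeights T).countP (j < ·) + 1 = G.numComponents j := by
  have h1 := isAcyclic_card_connectedComponent_add_card_edgeFinset
    (hT.2.1.isAcyclic.anti (G.below_le T j))
  rw [hT.card_connectedComponent] at h1
  have h2 := hT.2.1.card_edgeFinset
  have h3 : (G.below T j).edgeFinset = T.edgeFinset.filter fun e => ¬ j < G.weight e := by
    ext e
    induction e with | _ a b =>
    rw [mem_filter, SimpleGraph.mem_edgeFinset, SimpleGraph.mem_edgeFinset,
      SimpleGraph.mem_edgeSet, SimpleGraph.mem_edgeSet, not_lt]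
    rfl
  have h4 : (G.edgeWeights T).countP (j < ·) = #(T.edgeFinset.filter fun e => j < G.weight e) := by
    rw [edgeWeights, Multiset.countP_map]
    rfl
  have h5 := card_filter_add_card_filter_not (s := T.edgeFinset) (fun e => j < G.weight e)
  rw [h3] at h1
  omega

/-- The entries above j form a final segment of the sorted list, whose coefficients are m, m - 1, …,
1, with triangular sum. The factor 2 avoids division. -/
lemma sum_mul_gt_of_sorted (j : ℕ) (l : List ℕ) (hl : l.Pairwise (· ≤ ·)) :
    2 * ∑ i ∈ range l.length, (l.length - i) * (if j < l.getD i 0 then 1 else 0)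
      = l.countP (j < ·) * (l.countP (j < ·) + 1) := by
  induction l with
  | nil => simp
  | cons a l ih =>
    rw [List.pairwise_cons] at hl
    have ih := ih hl.2
    rw [List.length_cons, sum_range_succ', List.countP_cons]
    simp only [List.getD_cons_succ, List.getD_cons_zero, Nat.add_sub_add_right]
    by_cases h : j < a
    · have hall : l.countP (j < ·) = l.length := by
        rw [List.countP_eq_length]
        intro b hb
        simpa using h.trans_le (hl.1 b hb)
      rw [hall] at ih ⊢
      simp only [h, decide_true, if_true, mul_one, Nat.sub_zero]
      rw [mul_add, ih]
      ring
    · simpa [h] using ih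

/-- The single-linkage cost in terms of the numbers of components. -/
lemma IsMST.slcCost_eq {G : WeightedGraph n W} {T : SimpleGraph (Fin n)} (hT : G.IsMST T) :
    (G.slcCost T : ℝ)
      = 1 / 2 * ∑ j ∈ range W, ((G.numComponents j : ℝ) ^ 2 - G.numComponents j) := by
  classical
  set l := (G.edgeWeights T).sort (· ≤ ·) with hl
  have hcoe : (l : Multiset ℕ) = G.edgeWeights T := Multiset.sort_eq _ _
  have hlen : l.length = n - 1 := by
    have := hT.2.1.card_edgeFinset
    rw [hl, Multiset.length_sort, edgeWeights, Multiset.card_map]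
    rw [Fintype.card_fin] at this
    change #T.edgeFinset = _
    omega
  have hW : ∀ i, l.getD i 0 ≤ W := by
    intro i
    by_cases hi : i < l.length
    · rw [List.getD_eq_getElem _ _ hi]
      have : l[i] ∈ G.edgeWeights T := by
        rw [← hcoe]
        exact List.getElem_mem hi
      obtain ⟨e, he, hw⟩ := Multiset.mem_map.1 this
      rw [← hw]
      exact G.weight_le _ (SimpleGraph.edgeSet_mono hT.1 (by simpa using he))
    · rw [List.getD_eq_default _ _ (by omega)]
      omega
  -- A weight w ≤ W is the number of j < W with j < w; the two sums are then exchanged.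
  have h1 : G.slcCost T = ∑ j ∈ range W,
      ∑ i ∈ range l.length, (l.length - i) * (if j < l.getD i 0 then 1 else 0) := by
    rw [sum_comm, slcCost, ← hl, hlen, ← Finset.Ico_add_one_right_eq_Icc,
      Finset.sum_Ico_eq_sum_range]
    refine sum_congr rfl fun i _ => ?_
    rw [← mul_sum, sum_boole, show 1 + i - 1 = i by omega, show n - (1 + i) = n - 1 - i by omega]
    congr 1
    have : (range W).filter (· < l.getD i 0) = range (l.getD i 0) := by
      ext k
      have := hW i
      simp only [mem_filter, mem_range]
      omega
    rw [this]
    simp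
  rw [h1, Nat.cast_sum, mul_sum]
  refine sum_congr rfl fun j _ => ?_
  have h2 := sum_mul_gt_of_sorted j l (Multiset.pairwise_sort _ _)
  have h3 := hT.countP_edgeWeights j
  rw [← hcoe, Multiset.coe_countP] at h3
  rw [← h3]
  have h4 := congrArg (Nat.cast (R := ℝ)) h2
  rw [Nat.cast_mul] at h4
  push_cast at h4 ⊢
  linarith

end WeightedGraph

open Prog

/-! ### Breadth first search -/

variable {n W : ℕ} {G : WeightedGraph n W}

namespace WeightedGraph.AdjLists

lemma mem_list (adj : G.AdjLists) {v u : Fin n} (h : G.graph.Adj v u) :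
    (u, G.weight s(v, u)) ∈ adj.list v :=
  (adj.mem_iff v u _).2 ⟨h, rfl⟩

lemma length_pos (adj : G.AdjLists) {v u : Fin n} (h : G.graph.Adj v u) :
    0 < (adj.list v).length :=
  List.length_pos_of_mem (adj.mem_list h)

open Classical in
lemma length_eq_degree (adj : G.AdjLists) (v : Fin n) :
    (adj.list v).length = G.graph.degree v := by
  rw [← List.toFinset_card_of_nodup (adj.nodup v), ← SimpleGraph.card_neighborFinset_eq_degree]
  refine Finset.card_bij (fun x _ => x.1) ?_ ?_ ?_
  · intro x hx
    rw [SimpleGraph.mem_neighborFinset]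
    exact ((adj.mem_iff v x.1 x.2).1 (by simpa using hx)).1
  · rintro ⟨x, a⟩ hx ⟨y, b⟩ hy rfl
    have h1 := ((adj.mem_iff v x a).1 (by simpa using hx)).2
    have h2 := ((adj.mem_iff v x b).1 (by simpa using hy)).2
    rw [h1, h2]
  · intro w hw
    rw [SimpleGraph.mem_neighborFinset] at hw
    exact ⟨_, by simpa using adj.mem_list hw, rfl⟩

lemma length_le (adj : G.AdjLists) (v : Fin n) : (adj.list v).length ≤ n := by
  classical
  rw [adj.length_eq_degree]
  exact ((G.graph.degree_lt_card_verts v).trans_eq (Fintype.card_fin n)).le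

end WeightedGraph.AdjLists

/-- The state after one step of the search. -/
def bfsNext (adj : Fin n → List (Fin n × ℕ)) (j : ℕ) (s : BFS n) : BFS n :=
  match s.pending with
  | [] => s
  | (c, i) :: q =>
    match lookup adj c with
    | none => { s with pending := q }
    | some e =>
      let q₁ : List (Pointer n × ℕ) :=
        match e.next with
        | some c' => (c', i + 1) :: q
        | none => q
      let isNew : Prop := e.wt ≤ j ∧ e.nbr ∉ s.visited
      { visited := if isNew then insert e.nbr s.visited else s.visited
        pending := if isNew then q₁ ++ [(Pointer.head e.nbr, 0)] else q₁
        edges := s.edges + 1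
        maxRead := max s.maxRead (i + 1) }

/-- A step is deterministic and costs one unit of work and one read. With an empty queue nothing
would be read. -/
lemma ev_bfsStep (adj : Fin n → List (Fin n × ℕ)) (τ : ℝ) (j : ℕ) (s : BFS n)
    (hs : s.pending ≠ []) (f : BFS n → ℝ) :
    ev adj τ (bfsStep j s) f = τ * 2 + f (bfsNext adj j s) := by
  rcases hp : s.pending with _ | ⟨⟨c, i⟩, q⟩
  · exact absurd hp hs
  · simp only [bfsStep, bfsNext, hp, ev_bind, ev_doWork, ev_readCell]
    rcases lookup adj c with _ | e
    · simp only [ev_pure]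
      push_cast
      ring
    · simp only [ev_pure]
      rw [← add_assoc]
      refine congrArg₂ (· + ·) ?_ rfl
      push_cast
      ring

/-- The state after `k` steps of the search from `u`. -/
def bfsState (adj : Fin n → List (Fin n × ℕ)) (j : ℕ) (u : Fin n) (k : ℕ) : BFS n :=
  (bfsNext adj j)^[k] (BFS.init u)

lemma bfsState_succ (adj : Fin n → List (Fin n × ℕ)) (j : ℕ) (u : Fin n) (k : ℕ) :
    bfsState adj j u (k + 1) = bfsNext adj j (bfsState adj j u k) :=
  Function.iterate_succ_apply' _ _ _

/-- The invariant of the search from `u`; `rd v` is the number of cells read from the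
list of `v`. -/
structure BFS.Inv (adj : G.AdjLists) (j : ℕ) (u : Fin n) (s : BFS n) (rd : Fin n → ℕ) :
    Prop where
  root : u ∈ s.visited
  reach : ∀ v ∈ s.visited, (G.below G.graph j).Reachable u v
  nodup : (s.pending.map fun x => x.1.vertex).Nodup
  pend : ∀ x ∈ s.pending, x.1.vertex ∈ s.visited ∧ x.1.pos = rd x.1.vertex ∧ x.2 = x.1.pos ∧
    x.1.pos < (adj.list x.1.vertex).length
  done : ∀ v ∈ s.visited, (∀ x ∈ s.pending, x.1.vertex ≠ v) → rd v = (adj.list v).length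
  unvisited : ∀ v ∉ s.visited, rd v = 0
  edges : s.edges = ∑ v, rd v
  rd_le : ∀ v, rd v ≤ s.maxRead
  maxRead_le : ∃ v ∈ s.visited, s.maxRead ≤ (adj.list v).length
  closed : ∀ v w a i, i < rd v → (adj.list v)[i]? = some (w, a) → a ≤ j → w ∈ s.visited

section

variable {adj : G.AdjLists} {j : ℕ} {u : Fin n} {s : BFS n} {rd : Fin n → ℕ}

lemma BFS.inv_init (hu : 0 < (adj.list u).length) :
    (BFS.init u).Inv adj j u fun _ => 0 where
  root := by simp [BFS.init]
  reach v hv := by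
    obtain rfl : v = u := by simpa [BFS.init] using hv
    exact SimpleGraph.Reachable.rfl
  nodup := by simp [BFS.init]
  pend x hx := by
    obtain rfl : x = (Pointer.head u, 0) := by simpa [BFS.init] using hx
    simp [BFS.init, Pointer.head, hu]
  done v hv h := by
    obtain rfl : v = u := by simpa [BFS.init] using hv
    exact absurd rfl (h (Pointer.head v, 0) (by simp [BFS.init]))
  unvisited _ _ := rfl
  edges := by simp [BFS.init]
  rd_le _ := by simp [BFS.init]
  maxRead_le := ⟨u, by simp [BFS.init], by simp [BFS.init]⟩
  closed _ _ _ _ h := by simp at h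

/-- The cell at the head of the queue, and the next state. -/
lemma BFS.Inv.exists_cell (h : s.Inv adj j u rd) {c : Pointer n} {i : ℕ}
    {q : List (Pointer n × ℕ)} (hp : s.pending = (c, i) :: q) :
    ∃ w a, (adj.list c.vertex)[c.pos]? = some (w, a) ∧
      bfsNext adj.list j s =
        { visited := if a ≤ j ∧ w ∉ s.visited then insert w s.visited else s.visited
          pending := (if c.pos + 1 < (adj.list c.vertex).length
              then [(⟨c.vertex, c.pos + 1⟩, c.pos + 1)] else []) ++ q ++
            if a ≤ j ∧ w ∉ s.visited then [(Pointer.head w, 0)] else []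
          edges := s.edges + 1
          maxRead := max s.maxRead (c.pos + 1) } := by
  obtain ⟨-, -, hi, hlt⟩ := h.pend (c, i) (by simp [hp])
  simp only at hi hlt
  subst hi
  refine ⟨((adj.list c.vertex)[c.pos]).1, ((adj.list c.vertex)[c.pos]).2, by simp [hlt], ?_⟩
  simp only [bfsNext, hp, lookup, List.getElem?_eq_getElem hlt, Option.map_some]
  congr 1
  by_cases h1 : c.pos + 1 < (adj.list c.vertex).length
  · simp only [h1, if_true]
    split_ifs <;> simp
  · simp only [h1, if_false]
    split_ifs <;> simp

/-- Only the list at the head of the queue gains a read cell, and no other queue entry refers to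
that list because the vertices in the queue are distinct. A newly found vertex has read count 0,
being unvisited, and its list is nonempty because it contains the edge back. -/
lemma BFS.Inv.next (h : s.Inv adj j u rd) {c : Pointer n} {i : ℕ}
    {q : List (Pointer n × ℕ)} (hp : s.pending = (c, i) :: q) :
    (bfsNext adj.list j s).Inv adj j u
      (Function.update rd c.vertex (rd c.vertex + 1)) := by
  obtain ⟨w, a, hcell, hnext⟩ := h.exists_cell hp
  obtain ⟨hcv, hrd, hi, hlt⟩ := h.pend (c, i) (by simp [hp])
  simp only at hcv hrd hi hlt
  have hmem : (w, a) ∈ adj.list c.vertex := List.mem_of_getElem? hcell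
  obtain ⟨hadj, ha⟩ := (adj.mem_iff _ _ _).1 hmem
  have hnd := h.nodup
  rw [hp, List.map_cons, List.nodup_cons] at hnd
  have hq : ∀ x ∈ q, x ∈ s.pending := fun x hx => by rw [hp]; exact List.mem_cons_of_mem _ hx
  have hqv : ∀ x ∈ q, x.1.vertex ≠ c.vertex := fun x hx he =>
    hnd.1 (List.mem_map.2 ⟨x, hx, he⟩)
  rw [hnext]
  have hsub : ∀ v, v ∈ s.visited → v ∈ (if a ≤ j ∧ w ∉ s.visited then insert w s.visited
      else s.visited) := by
    intro v hv
    split_ifs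
    · exact mem_insert_of_mem hv
    · exact hv
  have hsub' : ∀ v, v ∈ (if a ≤ j ∧ w ∉ s.visited then insert w s.visited else s.visited) →
      v ∈ s.visited ∨ (v = w ∧ a ≤ j ∧ w ∉ s.visited) := by
    intro v hv
    split_ifs at hv with h1
    · rcases mem_insert.1 hv with h2 | h2
      · exact Or.inr ⟨h2, h1⟩
      · exact Or.inl h2
    · exact Or.inl hv
  have hpend : ∀ x, x ∈ (if c.pos + 1 < (adj.list c.vertex).length
              then [((⟨c.vertex, c.pos + 1⟩ : Pointer n), c.pos + 1)] else []) ++ q ++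
            (if a ≤ j ∧ w ∉ s.visited then [(Pointer.head w, 0)] else []) ↔
      (c.pos + 1 < (adj.list c.vertex).length ∧ x = (⟨c.vertex, c.pos + 1⟩, c.pos + 1)) ∨
      x ∈ q ∨ ((a ≤ j ∧ w ∉ s.visited) ∧ x = (Pointer.head w, 0)) := by
    intro x
    have hite : ∀ (p : Prop) [Decidable p] (y : Pointer n × ℕ),
        x ∈ (if p then [y] else []) ↔ p ∧ x = y := by
      intro p _ y
      split_ifs with h1 <;> simp [h1]
    rw [List.mem_append, List.mem_append, or_assoc, hite, hite]
  refine ⟨hsub _ h.root, ?_, ?_, ?_, ?_, ?_, ?_, ?_, ?_, ?_⟩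
  · intro v hv
    rcases hsub' v hv with hv | ⟨rfl, hj, -⟩
    · exact h.reach v hv
    · exact (h.reach _ hcv).trans (SimpleGraph.Adj.reachable ⟨hadj, ha ▸ hj⟩)
  · rw [List.map_append, List.map_append, List.nodup_append, List.nodup_append]
    refine ⟨⟨by split_ifs <;> simp, hnd.2, ?_⟩, by split_ifs <;> simp, ?_⟩
    · intro x hx y hy
      split_ifs at hx
      · obtain rfl : x = c.vertex := by simpa using hx
        obtain ⟨z, hz, rfl⟩ := List.mem_map.1 hy
        exact (hqv z hz).symm
      · simp at hx
    · intro x hx y hy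
      split_ifs at hy with h1
      · obtain rfl : y = w := by simpa [Pointer.head] using hy
        rintro rfl
        refine h1.2 ?_
        rcases List.mem_append.1 hx with hx | hx
        · split_ifs at hx
          · obtain rfl : x = c.vertex := by simpa using hx
            exact hcv
          · simp at hx
        · obtain ⟨z, hz, rfl⟩ := List.mem_map.1 hx
          exact (h.pend z (hq z hz)).1
      · simp at hy
  · intro x hx
    rcases (hpend x).1 hx with ⟨h1, rfl⟩ | hx | ⟨h1, rfl⟩
    · refine ⟨hsub _ hcv, ?_, rfl, h1⟩
      simp [← hrd]
    · obtain ⟨h1, h2, h3, h4⟩ := h.pend x (hq x hx)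
      refine ⟨hsub _ h1, ?_, h3, h4⟩
      rw [Function.update_of_ne (hqv x hx), h2]
    · have hwc : w ≠ c.vertex := fun he => h1.2 (he ▸ hcv)
      refine ⟨?_, ?_, rfl, adj.length_pos hadj.symm⟩
      · rw [if_pos h1]
        exact mem_insert_self _ _
      · simp [Pointer.head, Function.update_of_ne hwc, h.unvisited w h1.2]
  · intro v hv hnp
    have hvw : v = w → ¬ (a ≤ j ∧ w ∉ s.visited) := by
      rintro rfl h1
      exact hnp _ ((hpend _).2 (Or.inr (Or.inr ⟨h1, rfl⟩))) rfl
    have hvs : v ∈ s.visited := by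
      rcases hsub' v hv with hv | ⟨h1, h2⟩
      · exact hv
      · exact absurd h2 (hvw h1)
    by_cases hvc : v = c.vertex
    · subst hvc
      have : ¬ c.pos + 1 < (adj.list c.vertex).length := fun h1 =>
        hnp _ ((hpend _).2 (Or.inl ⟨h1, rfl⟩)) rfl
      rw [Function.update_self]
      omega
    · rw [Function.update_of_ne hvc]
      refine h.done v hvs fun x hx => ?_
      rw [hp] at hx
      rcases List.mem_cons.1 hx with rfl | hx
      · exact fun he => hvc he.symm
      · exact hnp x ((hpend x).2 (Or.inr (Or.inl hx)))
  · intro v hv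
    have hvs : v ∉ s.visited := fun h1 => hv (hsub v h1)
    rw [Function.update_of_ne (fun he => hvs (by rwa [he])), h.unvisited v hvs]
  · change s.edges + 1 = _
    rw [h.edges, Finset.sum_update_of_mem (mem_univ _), ← Finset.add_sum_erase univ rd
      (mem_univ c.vertex), Finset.sdiff_singleton_eq_erase]
    ring
  · intro v
    change _ ≤ max _ _
    by_cases hvc : v = c.vertex
    · subst hvc
      rw [Function.update_self, ← hrd]
      exact le_max_right _ _
    · rw [Function.update_of_ne hvc]
      exact (h.rd_le v).trans (le_max_left _ _)
  · rcases le_total s.maxRead (c.pos + 1) with h1 | h1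
    · refine ⟨c.vertex, hsub _ hcv, ?_⟩
      change max _ _ ≤ _
      rw [max_eq_right h1]
      exact hlt
    · obtain ⟨v, hv, hle⟩ := h.maxRead_le
      refine ⟨v, hsub _ hv, ?_⟩
      change max _ _ ≤ _
      rwa [max_eq_left h1]
  · intro v w' a' i' hi' hget ha'
    change w' ∈ ite _ _ _
    by_cases hvc : v = c.vertex
    · subst hvc
      rw [Function.update_self] at hi'
      rcases (Nat.lt_succ_iff_lt_or_eq.1 hi') with h1 | h1
      · exact hsub _ (h.closed _ _ _ _ h1 hget ha')
      · rw [h1, ← hrd, hcell] at hget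
        simp only [Option.some.injEq, Prod.mk.injEq] at hget
        obtain ⟨rfl, rfl⟩ := hget
        by_cases hw : w ∈ s.visited
        · exact hsub _ hw
        · rw [if_pos ⟨ha', hw⟩]
          exact mem_insert_self _ _
    · rw [Function.update_of_ne hvc] at hi'
      exact hsub _ (h.closed _ _ _ _ hi' hget ha')

/-! ### The volume of a component and the exhaustion of the search -/

open Classical in
/-- The total length of the lists of the vertices in the component of `u`. -/
def volume (adj : G.AdjLists) (j : ℕ) (u : Fin n) : ℕ :=
  ∑ v with (G.below G.graph j).Reachable u v, (adj.list v).length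

/-- This is why the cap `n ^ 2 + 1` on the loops is never reached. -/
lemma volume_le (adj : G.AdjLists) (j : ℕ) (u : Fin n) : volume adj j u ≤ n ^ 2 := by
  classical
  calc volume adj j u ≤ ∑ v : Fin n, (adj.list v).length :=
        Finset.sum_le_sum_of_subset (filter_subset _ _)
    _ ≤ ∑ _v : Fin n, n := Finset.sum_le_sum fun v _ => adj.length_le v
    _ = n ^ 2 := by simp [sq]

lemma length_le_volume (adj : G.AdjLists) (j : ℕ) (u : Fin n) :
    (adj.list u).length ≤ volume adj j u := by
  classical
  exact Finset.single_le_sum (f := fun v => (adj.list v).length) (fun _ _ => Nat.zero_le _)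
    (by simp)

lemma BFS.Inv.rd_le_length (h : s.Inv adj j u rd) (v : Fin n) :
    rd v ≤ (adj.list v).length := by
  by_cases hv : v ∈ s.visited
  · by_cases hx : ∃ x ∈ s.pending, x.1.vertex = v
    · obtain ⟨x, hx, rfl⟩ := hx
      obtain ⟨-, h1, -, h2⟩ := h.pend x hx
      omega
    · push Not at hx
      exact (h.done v hv hx).le
  · simp [h.unvisited v hv]

open Classical in
lemma BFS.Inv.edges_eq_sum_reachable (h : s.Inv adj j u rd) :
    s.edges = ∑ v with (G.below G.graph j).Reachable u v, rd v := by
  rw [h.edges]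
  symm
  refine Finset.sum_subset (filter_subset _ _) fun v _ hv => h.unvisited v fun h1 => hv ?_
  simpa using h.reach v h1

lemma BFS.Inv.edges_lt (h : s.Inv adj j u rd) (hp : s.pending ≠ []) :
    s.edges < volume adj j u := by
  classical
  rw [h.edges_eq_sum_reachable, volume]
  obtain ⟨x, hx⟩ := List.exists_mem_of_ne_nil _ hp
  obtain ⟨h1, h2, -, h4⟩ := h.pend x hx
  exact Finset.sum_lt_sum (fun v _ => h.rd_le_length v)
    ⟨x.1.vertex, by simpa using h.reach _ h1, by omega⟩

/-- With an empty queue every visited list has been read completely, so the visited set is closed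
under edges of weight at most j and is the whole component. -/
lemma BFS.Inv.edges_eq (h : s.Inv adj j u rd) (hp : s.pending = []) :
    s.edges = volume adj j u := by
  classical
  rw [h.edges_eq_sum_reachable, volume]
  have hrd : ∀ v ∈ s.visited, rd v = (adj.list v).length := fun v hv =>
    h.done v hv (by simp [hp])
  have hcl : ∀ v w, (G.below G.graph j).Reachable v w → v ∈ s.visited → w ∈ s.visited := by
    rintro v w ⟨p⟩
    induction p with
    | nil => exact id
    | @cons a b c hab p ih =>
      intro ha
      refine ih ?_
      obtain ⟨i, hi, hget⟩ := List.getElem_of_mem (adj.mem_list hab.1)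
      exact h.closed a b _ i (by rw [hrd a ha]; exact hi) (List.getElem?_eq_some_iff.2 ⟨hi, hget⟩)
        hab.2
  refine Finset.sum_congr rfl fun v hv => hrd v (hcl u v (by simpa using hv) h.root)

/-- This converts the thresholds on visited vertices and on cells per list into a bound Γ D on the
cells read when the search is resumed. -/
lemma BFS.Inv.edges_le (h : s.Inv adj j u rd) : s.edges ≤ #s.visited * s.maxRead := by
  rw [h.edges, ← Finset.sum_subset (subset_univ s.visited) fun v _ hv => h.unvisited v hv]
  exact Finset.sum_le_card_nsmul _ _ _ fun v _ => h.rd_le v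

/-- Before the volume is exhausted the queue is nonempty and each step reads exactly one cell. Hence
the search is described by the single parameter k, its number of steps and of cells read. -/
lemma exists_inv_bfsState (hu : 0 < (adj.list u).length) {k : ℕ} (hk : k ≤ volume adj j u) :
    ∃ rd, (bfsState adj.list j u k).Inv adj j u rd ∧ (bfsState adj.list j u k).edges = k := by
  induction k with
  | zero => exact ⟨_, BFS.inv_init hu, rfl⟩
  | succ k ih =>
    obtain ⟨rd, h, he⟩ := ih (by omega)
    rcases hp : (bfsState adj.list j u k).pending with _ | ⟨⟨c, i⟩, q⟩
    · have := h.edges_eq hp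
      omega
    · rw [bfsState_succ]
      obtain ⟨w, a, -, hnext⟩ := h.exists_cell hp
      exact ⟨_, h.next hp, by rw [hnext, he]⟩

lemma bfsState_edges (hu : 0 < (adj.list u).length) {k : ℕ} (hk : k ≤ volume adj j u) :
    (bfsState adj.list j u k).edges = k :=
  (exists_inv_bfsState hu hk).choose_spec.2

lemma bfsState_pending_eq_nil_iff (hu : 0 < (adj.list u).length) {k : ℕ}
    (hk : k ≤ volume adj j u) :
    (bfsState adj.list j u k).pending = [] ↔ k = volume adj j u := by
  obtain ⟨rd, h, he⟩ := exists_inv_bfsState (j := j) hu hk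
  constructor
  · intro hp
    rw [← he, h.edges_eq hp]
  · intro hkv
    by_contra hp
    have := h.edges_lt hp
    omega

/-- New vertices join the back of the queue, so the list of u is scanned to its end first. -/
lemma bfsState_pending_of_lt (hu : 0 < (adj.list u).length) {k : ℕ}
    (hk : k < (adj.list u).length) :
    ∃ q, (bfsState adj.list j u k).pending = (⟨u, k⟩, k) :: q := by
  induction k with
  | zero => exact ⟨[], rfl⟩
  | succ k ih =>
    obtain ⟨q, hq⟩ := ih (by omega)
    have := length_le_volume adj j u
    obtain ⟨rd, h, he⟩ := exists_inv_bfsState (adj := adj) (j := j) (k := k) hu (by omega)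
    obtain ⟨w, a, -, hnext⟩ := h.exists_cell hq
    rw [bfsState_succ, hnext]
    exact ⟨_, by simp [hk]; rfl⟩

/-- The vertex u is visited from the start and so never queued again; thus the first phase stops
after exactly the length of the list of u. -/
lemma bfsState_length_head (hu : 0 < (adj.list u).length) :
    (bfsState adj.list j u (adj.list u).length).pending.head?.map (fun x => x.1.vertex)
      ≠ some u := by
  obtain ⟨k, hk⟩ : ∃ k, (adj.list u).length = k + 1 := ⟨_, (Nat.sub_add_cancel hu).symm⟩
  obtain ⟨q, hq⟩ := bfsState_pending_of_lt (adj := adj) (j := j) (k := k) hu (by omega)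
  have := length_le_volume adj j u
  obtain ⟨rd, h, he⟩ := exists_inv_bfsState (adj := adj) (j := j) (k := k) hu (by omega)
  obtain ⟨w, a, -, hnext⟩ := h.exists_cell hq
  have hnd := h.nodup
  rw [hq, List.map_cons, List.nodup_cons] at hnd
  rw [hk, bfsState_succ, hnext]
  simp only [hk, lt_irrefl, if_false, List.nil_append]
  intro hc
  obtain ⟨x, hx, hxu⟩ := Option.map_eq_some_iff.1 hc
  have hx := List.mem_of_mem_head? hx
  rcases List.mem_append.1 hx with hx | hx
  · exact hnd.1 (List.mem_map.2 ⟨x, hx, hxu⟩)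
  · split_ifs at hx with h1
    · obtain rfl : x = (Pointer.head w, 0) := by simpa using hx
      obtain rfl : w = u := hxu
      exact h1.2 h.root
    · simp at hx

lemma ev_bfsFirst (hu : 0 < (adj.list u).length) (τ : ℝ) (f : BFS n → ℝ) :
    ev adj.list τ (bfsFirst j u) f
      = τ * (2 * (adj.list u).length) + f (bfsState adj.list j u (adj.list u).length) := by
  have hvol := length_le_volume adj j u
  have key : ∀ N k, k < (adj.list u).length → (adj.list u).length ≤ k + N →
      ev adj.list τ (loop N (fun s => do
        let s' ← bfsStep j s
        pure (s', decide (s'.pending.head?.map (fun x => x.1.vertex) = some u)))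
        (bfsState adj.list j u k)) f
      = τ * (2 * ((adj.list u).length - k))
        + f (bfsState adj.list j u (adj.list u).length) := by
    intro N
    induction N with
    | zero => intro k h1 h2; omega
    | succ N ih =>
      intro k h1 h2
      have hne : (bfsState adj.list j u k).pending ≠ [] := by
        rw [Ne, bfsState_pending_eq_nil_iff hu (by omega)]
        omega
      simp only [loop, ev_bind, ev_bfsStep _ _ _ _ hne, ev_pure, ← bfsState_succ,
        decide_eq_true_eq]
      rcases Nat.lt_or_ge (k + 1) (adj.list u).length with h3 | h3
      · obtain ⟨q, hq⟩ := bfsState_pending_of_lt (adj := adj) (j := j) hu h3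
        rw [if_pos (by simp [hq]), ih (k + 1) h3 (by omega)]
        push_cast
        ring
      · have h4 : k + 1 = (adj.list u).length := by omega
        rw [if_neg (by rw [h4]; exact bfsState_length_head hu), ev_pure, h4, ← h4]
        push_cast
        ring
  have := key (n ^ 2 + 1) 0 hu (by have := volume_le adj j u; omega)
  rw [bfsFirst]
  refine this.trans ?_
  simp

lemma ev_bfsResume (hu : 0 < (adj.list u).length) (τ : ℝ) (f : BFS n → ℝ) {k b : ℕ}
    (hk : k < volume adj j u) (hb : k < b) :
    ev adj.list τ (bfsResume j b (bfsState adj.list j u k)) f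
      = τ * (2 * ((min b (volume adj j u) : ℕ) - k))
        + f (bfsState adj.list j u (min b (volume adj j u))) := by
  have key : ∀ N k, k < volume adj j u → k < b → volume adj j u ≤ k + N →
      ev adj.list τ (loop N (fun s => do
        let s' ← bfsStep j s
        pure (s', decide (s'.pending ≠ [] ∧ s'.edges < b)))
        (bfsState adj.list j u k)) f
      = τ * (2 * ((min b (volume adj j u) : ℕ) - k))
        + f (bfsState adj.list j u (min b (volume adj j u))) := by
    intro N
    induction N with
    | zero => intro k h1 _ h2; omega
    | succ N ih =>
      intro k h1 hb h2
      have hne : (bfsState adj.list j u k).pending ≠ [] := by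
        rw [Ne, bfsState_pending_eq_nil_iff hu (by omega)]
        omega
      simp only [loop, ev_bind, ev_bfsStep _ _ _ _ hne, ev_pure, ← bfsState_succ,
        decide_eq_true_eq]
      have hiff : ((bfsState adj.list j u (k + 1)).pending ≠ [] ∧
          (bfsState adj.list j u (k + 1)).edges < b) ↔ k + 1 < volume adj j u ∧ k + 1 < b := by
        rw [Ne, bfsState_pending_eq_nil_iff hu (by omega), bfsState_edges hu (by omega)]
        omega
      by_cases h3 : k + 1 < volume adj j u ∧ k + 1 < b
      · rw [if_pos (hiff.2 h3), ih (k + 1) h3.1 h3.2 (by omega)]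
        push_cast
        ring
      · rw [if_neg (fun h => h3 (hiff.1 h)), ev_pure]
        have h4 : min b (volume adj j u) = k + 1 := by omega
        rw [h4]
        push_cast
        ring
  exact key (n ^ 2 + 1) k hk hb (by have := volume_le adj j u; omega)

end

/-! ### The estimator for a sampled vertex -/

/-- The body of the loop of `sampleBeta`. -/
def betaBody (j Γ : ℕ) (D : ℝ) (s₀ : BFS n) (x : BFS n × ℕ × ℝ) :
    Prog n ((BFS n × ℕ × ℝ) × Bool) := do
  let (s, p, _) := x
  doWork 1
  let heads ← flipCoin
  if heads = true ∧ s.visited.card < Γ ∧ (s.maxRead : ℝ) ≤ D then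
    let s' ← bfsResume j (2 * s.edges) s
    if s'.pending = [] then
      pure ((s', 2 * p, (s₀.edges : ℝ) * ((2 * p : ℕ) : ℝ) / (s'.edges : ℝ)), false)
    else
      pure ((s', 2 * p, 0), true)
  else
    pure ((s, 2 * p, 0), false)

lemma sampleBeta_eq (j Γ : ℕ) (D : ℝ) (u : Fin n) :
    sampleBeta j Γ D u = (do
      let s₀ ← bfsFirst j u
      doWork 1
      if s₀.pending = [] then pure 1
      else do
        let res ← loop (n ^ 2 + 1) (betaBody j Γ D s₀) (s₀, 1, 0)
        pure res.2.2) := rfl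

/-- The search from `u` may be resumed after `k` steps. -/
def MayResume (adj : G.AdjLists) (j Γ : ℕ) (D : ℝ) (u : Fin n) (k : ℕ) : Prop :=
  #(bfsState adj.list j u k).visited < Γ ∧ ((bfsState adj.list j u k).maxRead : ℝ) ≤ D

section

variable {adj : G.AdjLists} {j Γ : ℕ} {D τ : ℝ} {u : Fin n}

/-- The expectation over the loop of `sampleBeta`, resumed after `k` steps. -/
def evBeta (adj : G.AdjLists) (j Γ : ℕ) (D τ : ℝ) (u : Fin n) (f : ℝ → ℝ) (N k p : ℕ) : ℝ :=
  ev adj.list τ (loop N (betaBody j Γ D (bfsState adj.list j u (adj.list u).length))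
    (bfsState adj.list j u k, p, 0)) fun r => f r.2.2

lemma evBeta_zero (f : ℝ → ℝ) (k p : ℕ) : evBeta adj j Γ D τ u f 0 k p = f 0 := rfl

open Classical in
-- The search being deterministic, the coin is the only randomness of a round. Heads leads from (k,
-- p) to (2k, 2p) or to completion; in all other cases β = 0.
lemma evBeta_succ (hu : 0 < (adj.list u).length) (f : ℝ → ℝ) (N p : ℕ) {k : ℕ} (hk0 : 0 < k)
    (hk : k < volume adj j u) :
    evBeta adj j Γ D τ u f (N + 1) k p
      = 2 * τ + ((if MayResume adj j Γ D u k then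
          τ * (2 * ((min (2 * k) (volume adj j u) : ℕ) - k)) +
            if volume adj j u ≤ 2 * k then
              f ((adj.list u).length * (2 * p : ℕ) / volume adj j u)
            else evBeta adj j Γ D τ u f N (2 * k) (2 * p)
        else f 0) + f 0) / 2 := by
  have hlen := length_le_volume adj j u
  rw [evBeta, loop]
  simp only [betaBody, ev_bind, ev_doWork, ev_flipCoin, true_and, false_and,
    if_false, ev_pure, Bool.false_eq_true]
  by_cases hc : MayResume adj j Γ D u k
  · have hc' := hc
    rw [MayResume] at hc'
    rw [if_pos hc', if_pos hc]
    simp only [ev_bind, bfsState_edges hu hk.le]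
    rw [ev_bfsResume hu _ _ hk (by omega)]
    by_cases h2 : volume adj j u ≤ 2 * k
    · have h3 : min (2 * k) (volume adj j u) = volume adj j u := min_eq_right h2
      rw [h3, if_pos ((bfsState_pending_eq_nil_iff hu le_rfl).2 rfl), if_pos h2]
      simp only [ev_pure, bfsState_edges hu le_rfl, bfsState_edges hu hlen, Bool.false_eq_true,
        if_false]
      push_cast
      ring
    · have h3 : min (2 * k) (volume adj j u) = 2 * k := min_eq_left (by omega)
      rw [h3, if_neg (by rw [bfsState_pending_eq_nil_iff hu (by omega)]; omega), if_neg h2,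
        evBeta]
      simp only [ev_pure, if_true]
      push_cast
      ring
  · have hc' := hc
    rw [MayResume] at hc'
    rw [if_neg hc', if_neg hc]
    simp only [ev_pure, Bool.false_eq_true, if_false]
    push_cast
    ring

lemma ev_sampleBeta (hu : 0 < (adj.list u).length) (f : ℝ → ℝ) :
    ev adj.list τ (sampleBeta j Γ D u) f
      = τ * (2 * (adj.list u).length + 1) + if (adj.list u).length = volume adj j u then f 1
        else evBeta adj j Γ D τ u f (n ^ 2 + 1) (adj.list u).length 1 := by
  rw [sampleBeta_eq]
  simp only [ev_bind, ev_bfsFirst hu, ev_doWork,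
    bfsState_pending_eq_nil_iff hu (length_le_volume adj j u)]
  split_ifs with h
  · simp only [ev_pure]
    push_cast
    ring
  · simp only [ev_bind, ev_pure, evBeta]
    push_cast
    ring

/-- A bound on the moments of the estimator. -/
lemma evBeta_le (hu : 0 < (adj.list u).length) {f : ℝ → ℝ} {b : ℝ} (hb : 0 ≤ b) (hf0 : f 0 = 0)
    (hf : ∀ x, 0 ≤ x → x ≤ 2 → f x ≤ b * x) (N : ℕ) {k p : ℕ} (hk0 : 0 < k)
    (hk : k < volume adj j u) (hp : (adj.list u).length * p = k) :
    evBeta adj j Γ D 0 u f N k p ≤ b * (k / volume adj j u) := by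
  have hm : (0 : ℝ) < volume adj j u := by exact_mod_cast (by omega : 0 < volume adj j u)
  induction N generalizing k p with
  | zero => rw [evBeta_zero, hf0]; positivity
  | succ N ih =>
    rw [evBeta_succ hu f N p hk0 hk, hf0]
    have h0 : 0 ≤ b * ((k : ℝ) / volume adj j u) := by positivity
    split_ifs with h1 h2
    -- The invariant `hp` makes the final value of β equal to 2k/m ≤ 2, where m is the volume. It is
    -- taken with probability 1/2, whence the bound b k/m; in the other branch k doubles while the
    -- probability halves.
    · have h3 : ((adj.list u).length : ℝ) * (2 * p : ℕ) / volume adj j u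
          = 2 * (k / volume adj j u) := by
        rw [← hp]
        push_cast
        ring
      have h4 : (k : ℝ) / volume adj j u ≤ 1 := by
        rw [div_le_one hm]
        exact_mod_cast hk.le
      have := hf (2 * (k / volume adj j u)) (by positivity) (by linarith)
      rw [h3]
      linarith
    · have := ih (k := 2 * k) (p := 2 * p) (by omega) (by omega) (by rw [← hp]; ring)
      have h3 : ((2 * k : ℕ) : ℝ) / volume adj j u = 2 * (k / volume adj j u) := by
        push_cast
        ring
      rw [h3] at this
      linarith
    · linarith

/-- The estimator is unbiased on components on which the search is never cut off. -/
lemma le_evBeta (hu : 0 < (adj.list u).length)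
    (hc : ∀ k < volume adj j u, MayResume adj j Γ D u k) {N k p : ℕ} (hk0 : 0 < k)
    (hk : k < volume adj j u) (hN : volume adj j u ≤ k + N)
    (hp : (adj.list u).length * p = k) :
    (k / volume adj j u : ℝ) ≤ evBeta adj j Γ D 0 u id N k p := by
  induction N generalizing k p with
  | zero => omega
  | succ N ih =>
    rw [evBeta_succ hu id N p hk0 hk, if_pos (hc k hk)]
    simp only [id]
    split_ifs with h2
    · rw [← hp]
      push_cast
      apply le_of_eq
      ring
    · have := ih (k := 2 * k) (p := 2 * p) (by omega) (by omega) (by omega) (by rw [← hp]; ring)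
      have h3 : ((2 * k : ℕ) : ℝ) / volume adj j u = 2 * (k / volume adj j u) := by
        push_cast
        ring
      rw [h3] at this
      linarith

/-- A bound on the expected time. -/
lemma evBeta_time_le (hu : 0 < (adj.list u).length) {X : ℝ}
    (hX : ∀ k < volume adj j u, MayResume adj j Γ D u k → (k : ℝ) ≤ X) {R N k p : ℕ}
    (hk0 : 0 < k) (hk : k < volume adj j u) (hR : X < k * 2 ^ R) :
    evBeta adj j Γ D 1 u (fun _ => 0) N k p ≤ 4 + k * R := by
  -- Resuming costs at most 2k and happens with probability at most 1/2. As k doubles while the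
  -- probability halves, each of at most R rounds contributes k, and the fixed costs add up to at
  -- most 2 + 1 + 1/2 + … = 4.
  induction N generalizing k p R with
  | zero => rw [evBeta_zero]; positivity
  | succ N ih =>
    rw [evBeta_succ hu _ N p hk0 hk]
    have hmin : ((min (2 * k) (volume adj j u) : ℕ) : ℝ) ≤ 2 * k := by
      exact_mod_cast min_le_left _ _
    by_cases h1 : MayResume adj j Γ D u k
    · have hkX := hX k hk h1
      obtain ⟨R, rfl⟩ : ∃ R', R = R' + 1 := by
        refine ⟨R - 1, (Nat.sub_add_cancel ?_).symm⟩
        by_contra h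
        obtain rfl : R = 0 := by omega
        simp at hR
        linarith
      rw [if_pos h1]
      split_ifs with h2
      · push_cast at hmin ⊢
        have : (0 : ℝ) ≤ k * R := by positivity
        linarith
      · have := ih (R := R) (k := 2 * k) (p := 2 * p) (by omega) (by omega) (by
          refine hR.trans_eq ?_
          push_cast
          ring)
        push_cast at this hmin ⊢
        linarith
    · rw [if_neg h1]
      have : (0 : ℝ) ≤ k * R := by positivity
      linarith

/-- Used with f = `id`, b = 1 for the mean, with f(x) = x², b = 2 for the second moment, and with
f(x) = -x, b = 0 for nonnegativity of the mean. -/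
lemma ev_sampleBeta_le (hu : 0 < (adj.list u).length) {f : ℝ → ℝ} {b : ℝ} (hb : 0 ≤ b)
    (hf0 : f 0 = 0) (hf : ∀ x, 0 ≤ x → x ≤ 2 → f x ≤ b * x) :
    ev adj.list 0 (sampleBeta j Γ D u) f ≤ b * ((adj.list u).length / volume adj j u) := by
  have hlen := length_le_volume adj j u
  rw [ev_sampleBeta hu]
  split_ifs with h
  · rw [← h, div_self (by positivity)]
    linarith [hf 1 zero_le_one one_le_two]
  · rw [zero_mul, zero_add]
    exact evBeta_le hu hb hf0 hf _ hu (by omega) (by simp)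

lemma le_ev_sampleBeta (hu : 0 < (adj.list u).length)
    (hc : ∀ k < volume adj j u, MayResume adj j Γ D u k) :
    ((adj.list u).length / volume adj j u : ℝ) ≤ ev adj.list 0 (sampleBeta j Γ D u) id := by
  have hlen := length_le_volume adj j u
  rw [ev_sampleBeta hu]
  split_ifs with h
  · rw [← h, div_self (by positivity)]
    simp
  · rw [zero_mul, zero_add]
    exact le_evBeta hu hc hu (by omega) (by have := volume_le adj j u; omega) (by simp)

lemma ev_sampleBeta_time_le (hu : 0 < (adj.list u).length) {R : ℕ}
    (hR : Γ * D < 2 ^ R) :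
    ev adj.list 1 (sampleBeta j Γ D u) (fun _ => 0) ≤ 5 + (adj.list u).length * (2 + R) := by
  have hlen := length_le_volume adj j u
  have h1 : (1 : ℝ) ≤ (adj.list u).length := by exact_mod_cast hu
  rw [ev_sampleBeta hu]
  split_ifs with h
  · have : (0 : ℝ) ≤ (adj.list u).length * R := by positivity
    linarith
  · have := evBeta_time_le (adj := adj) (j := j) (Γ := Γ) (D := D) (N := n ^ 2 + 1) (p := 1) hu
      (X := Γ * D) (R := R) ?_ hu (by omega) ?_
    · linarith
    · intro k hk hres
      obtain ⟨rd, hinv, he⟩ := exists_inv_bfsState (adj := adj) (j := j) hu hk.le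
      have h2 := hinv.edges_le
      rw [he] at h2
      calc (k : ℝ) ≤ (#(bfsState adj.list j u k).visited : ℝ) *
            (bfsState adj.list j u k).maxRead := by exact_mod_cast h2
        _ ≤ Γ * D := by
          have := hres.1.le
          gcongr
          exact hres.2
    · refine hR.trans_le ?_
      exact le_mul_of_one_le_left (by positivity) h1

/-- The search is never cut off in a small component of vertices of small degree. -/
lemma mayResume_of_small (hu : 0 < (adj.list u).length)
    (hcard : ∀ A : Finset (Fin n), (∀ v ∈ A, (G.below G.graph j).Reachable u v) → #A < Γ)
    (hdeg : ∀ v, (G.below G.graph j).Reachable u v → ((adj.list v).length : ℝ) ≤ D) :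
    ∀ k < volume adj j u, MayResume adj j Γ D u k := by
  intro k hk
  obtain ⟨rd, hinv, he⟩ := exists_inv_bfsState (adj := adj) (j := j) hu hk.le
  refine ⟨hcard _ hinv.reach, ?_⟩
  obtain ⟨v, hv, hle⟩ := hinv.maxRead_le
  exact le_trans (by exact_mod_cast hle) (hdeg v (hinv.reach v hv))

end

/-! ### Estimating the number of components -/

lemma length_pos_of_connected (adj : G.AdjLists) (hn : 2 ≤ n) (hG : G.graph.Connected)
    (v : Fin n) : 0 < (adj.list v).length := by
  have : Nontrivial (Fin n) := Fin.nontrivial_iff_two_le.2 hn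
  obtain ⟨u, hu⟩ := hG.preconnected.exists_adj_of_nontrivial v
  exact adj.length_pos hu

lemma sum_length [NeZero n] (adj : G.AdjLists) :
    ∑ v, ((adj.list v).length : ℝ) = n * G.avgDegree := by
  classical
  have hn : (n : ℝ) ≠ 0 := NeZero.ne _
  rw [WeightedGraph.avgDegree, mul_div_cancel₀ _ hn]
  refine Finset.sum_congr rfl fun v _ => ?_
  rw [adj.length_eq_degree]

lemma one_le_avgDegree [NeZero n] (adj : G.AdjLists) (hu : ∀ v, 0 < (adj.list v).length) :
    1 ≤ G.avgDegree := by
  have hn : (0 : ℝ) < n := by exact_mod_cast NeZero.pos n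
  have h1 : (n : ℝ) ≤ ∑ v, ((adj.list v).length : ℝ) := by
    calc (n : ℝ) = ∑ _v : Fin n, (1 : ℝ) := by simp
      _ ≤ _ := Finset.sum_le_sum fun v _ => by exact_mod_cast hu v
  rw [sum_length] at h1
  nlinarith

section

variable {adj : G.AdjLists} {j : ℕ}

open Classical in
/-- The vertices of every component contribute `1` to the number of components. -/
lemma sum_fiber_length_div_volume (hu : ∀ v, 0 < (adj.list v).length)
    (c : (G.below G.graph j).ConnectedComponent) :
    ∑ u with (G.below G.graph j).connectedComponentMk u = c,
      ((adj.list u).length : ℝ) / volume adj j u = 1 := by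
  obtain ⟨u₀, rfl⟩ := c.exists_rep
  have hvol : ∀ u, (G.below G.graph j).connectedComponentMk u
      = (G.below G.graph j).connectedComponentMk u₀ → volume adj j u = volume adj j u₀ := by
    intro u h
    have h := SimpleGraph.ConnectedComponent.exact h
    refine Finset.sum_congr (filter_congr fun v _ => ⟨h.symm.trans, h.trans⟩) fun _ _ => rfl
  have h1 : ∑ u with (G.below G.graph j).connectedComponentMk u
      = (G.below G.graph j).connectedComponentMk u₀, ((adj.list u).length : ℝ) / volume adj j u
      = ∑ u with (G.below G.graph j).Reachable u₀ u,
        ((adj.list u).length : ℝ) / volume adj j u₀ := by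
    refine Finset.sum_congr (filter_congr fun v _ => ?_) fun v hv => ?_
    · rw [SimpleGraph.ConnectedComponent.eq]
      exact ⟨SimpleGraph.Reachable.symm, SimpleGraph.Reachable.symm⟩
    · rw [hvol v (SimpleGraph.ConnectedComponent.sound (by simpa using hv)).symm]
  have hpos : 0 < volume adj j u₀ := (hu u₀).trans_le (length_le_volume adj j u₀)
  refine h1.trans ?_
  rw [← Finset.sum_div, div_eq_one_iff_eq (by positivity), volume, Nat.cast_sum]

lemma sum_length_div_volume (hu : ∀ v, 0 < (adj.list v).length) :
    ∑ u, ((adj.list u).length : ℝ) / volume adj j u = G.numComponents j := by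
  classical
  have h := Finset.sum_fiberwise univ (G.below G.graph j).connectedComponentMk
    fun u => ((adj.list u).length : ℝ) / volume adj j u
  rw [← h, WeightedGraph.numComponents, Nat.card_eq_fintype_card]
  refine (Finset.sum_congr rfl fun c _ => ?_).trans (b := ∑ _c, (1 : ℝ)) (by simp)
  convert sum_fiber_length_div_volume hu c

lemma sum_ev_sampleBeta_le {Γ : ℕ} {D : ℝ} (hu : ∀ v, 0 < (adj.list v).length) {f : ℝ → ℝ}
    {b : ℝ} (hb : 0 ≤ b) (hf0 : f 0 = 0) (hf : ∀ x, 0 ≤ x → x ≤ 2 → f x ≤ b * x) :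
    ∑ u, ev adj.list 0 (sampleBeta j Γ D u) f ≤ b * G.numComponents j := by
  rw [← sum_length_div_volume hu, Finset.mul_sum]
  exact Finset.sum_le_sum fun u _ => ev_sampleBeta_le (hu u) hb hf0 hf

/-- At most n/Γ components have Γ or more vertices. By Markov's inequality at most n/Γ vertices have
degree above d Γ, each spoiling one component. Every other component is never cut off and
contributes at least 1. -/
lemma le_sum_ev_sampleBeta [NeZero n] {Γ : ℕ} (hΓ : 0 < Γ)
    (hu : ∀ v, 0 < (adj.list v).length) :
    (G.numComponents j : ℝ) - 2 * n / Γ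
      ≤ ∑ u, ev adj.list 0 (sampleBeta j Γ (G.avgDegree * Γ) u) id := by
  classical
  set H := G.below G.graph j with hH
  set D : ℝ := G.avgDegree * Γ with hD
  have hΓ' : (0 : ℝ) < Γ := by exact_mod_cast hΓ
  have hd := one_le_avgDegree adj hu
  let fib : H.ConnectedComponent → Finset (Fin n) := fun c =>
    univ.filter fun v => H.connectedComponentMk v = c
  let bigs : Finset H.ConnectedComponent := univ.filter fun c => Γ ≤ #(fib c)
  let heavy : Finset (Fin n) := univ.filter fun v => D < (adj.list v).length
  let bad : Finset H.ConnectedComponent := bigs ∪ heavy.image H.connectedComponentMk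
  have hbigs : (#bigs : ℝ) ≤ n / Γ := by
    rw [le_div_iff₀ hΓ']
    have h1 : #bigs * Γ ≤ ∑ c ∈ bigs, #(fib c) := by
      rw [← smul_eq_mul]
      exact Finset.card_nsmul_le_sum _ _ _ fun c hc => (mem_filter.1 hc).2
    have h2 : ∑ c ∈ bigs, #(fib c) ≤ ∑ c, #(fib c) :=
      Finset.sum_le_sum_of_subset (subset_univ _)
    have h3 : ∑ c, #(fib c) = n := by
      have := Finset.card_eq_sum_card_fiberwise (s := (univ : Finset (Fin n))) (t := univ)
        (f := H.connectedComponentMk) (by simp)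
      rw [card_univ, Fintype.card_fin] at this
      exact this.symm
    exact_mod_cast h1.trans (h2.trans_eq h3)
  have hheavy : (#heavy : ℝ) ≤ n / Γ := by
    rw [le_div_iff₀ hΓ']
    have h1 : (#heavy : ℝ) * D ≤ ∑ v ∈ heavy, ((adj.list v).length : ℝ) := by
      rw [← nsmul_eq_mul]
      exact Finset.card_nsmul_le_sum _ _ _ fun v hv => (mem_filter.1 hv).2.le
    have h2 : ∑ v ∈ heavy, ((adj.list v).length : ℝ) ≤ ∑ v, ((adj.list v).length : ℝ) :=
      Finset.sum_le_sum_of_subset_of_nonneg (subset_univ _) fun _ _ _ => by positivity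
    rw [sum_length] at h2
    have h3 : G.avgDegree * (#heavy * Γ) ≤ G.avgDegree * n := by
      rw [hD] at h1
      nlinarith
    exact le_of_mul_le_mul_left h3 (by linarith)
  have hbad : (#bad : ℝ) ≤ 2 * n / Γ := by
    have h1 : #bad ≤ #bigs + #heavy :=
      (card_union_le _ _).trans (Nat.add_le_add_left card_image_le _)
    have h2 : (#bad : ℝ) ≤ #bigs + #heavy := by exact_mod_cast h1
    calc (#bad : ℝ) ≤ n / Γ + n / Γ := by linarith
      _ = 2 * n / Γ := by ring
  have hgood : ∀ c, c ∉ bad → ∀ u ∈ fib c,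
      ((adj.list u).length : ℝ) / volume adj j u ≤ ev adj.list 0 (sampleBeta j Γ D u) id := by
    intro c hc u huc
    obtain rfl : H.connectedComponentMk u = c := (mem_filter.1 huc).2
    simp only [bad, bigs, heavy, mem_union, mem_filter, mem_univ, true_and, mem_image, not_or,
      not_le, not_exists, not_and] at hc
    refine le_ev_sampleBeta (hu u) (mayResume_of_small (hu u) ?_ ?_)
    · intro A hA
      refine (card_le_card fun v hv => ?_).trans_lt hc.1
      exact mem_filter.2 ⟨mem_univ _, SimpleGraph.ConnectedComponent.sound (hA v hv).symm⟩
    · intro v hv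
      by_contra hlt
      push Not at hlt
      exact hc.2 v hlt (SimpleGraph.ConnectedComponent.sound hv.symm)
  have hnonneg : ∀ u, 0 ≤ ev adj.list 0 (sampleBeta j Γ D u) id := by
    intro u
    have h1 := ev_sampleBeta_le (adj := adj) (j := j) (Γ := Γ) (D := D) (hu u)
      (f := fun x => -1 * x) (b := 0) le_rfl (by simp) (by intro x hx _; linarith)
    rw [ev_zero_mul] at h1
    change 0 ≤ ev adj.list 0 (sampleBeta j Γ D u) fun x => x
    linarith
  have hfib : ∑ u, ev adj.list 0 (sampleBeta j Γ D u) id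
      = ∑ c, ∑ u ∈ fib c, ev adj.list 0 (sampleBeta j Γ D u) id := by
    symm
    convert Finset.sum_fiberwise univ H.connectedComponentMk
      fun u => ev adj.list 0 (sampleBeta j Γ D u) id
  have hone : ∀ c, c ∉ bad → 1 ≤ ∑ u ∈ fib c, ev adj.list 0 (sampleBeta j Γ D u) id := by
    intro c hc
    refine le_trans (le_of_eq ?_) (Finset.sum_le_sum (hgood c hc))
    symm
    convert sum_fiber_length_div_volume hu c
  have hcard : (G.numComponents j : ℝ) = #bad + #badᶜ := by
    rw [WeightedGraph.numComponents, Nat.card_eq_fintype_card, ← card_add_card_compl bad]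
    push_cast
    rfl
  have hle : (#badᶜ : ℝ) ≤ ∑ u, ev adj.list 0 (sampleBeta j Γ D u) id := by
    rw [hfib]
    calc (#badᶜ : ℝ) = ∑ c ∈ badᶜ, (1 : ℝ) := by simp
      _ ≤ ∑ c ∈ badᶜ, ∑ u ∈ fib c, ev adj.list 0 (sampleBeta j Γ D u) id :=
        Finset.sum_le_sum fun c hc => hone c (mem_compl.1 hc)
      _ ≤ _ := Finset.sum_le_sum_of_subset_of_nonneg (subset_univ _) fun c _ _ =>
        Finset.sum_nonneg fun u _ => hnonneg u
  linarith

/-- The estimate of the number of components is accurate with probability at least `7 / 8`. -/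
lemma ev_approxCC_le [NeZero n] (hu : ∀ v, 0 < (adj.list v).length) {ε k : ℝ} (hε : 0 < ε)
    (hk : 0 < k) :
    ev adj.list 0 (approxCC j ε k G.avgDegree)
      (fun x => if |x - G.numComponents j| ≤ ε * max (G.numComponents j : ℝ) (n / k)
        then 0 else 1) ≤ 1 / 8 := by
  set c : ℝ := (G.numComponents j : ℝ) with hc
  set M : ℝ := max c (n / k) with hM
  set r : ℕ := ⌈64 * k / ε ^ 2⌉₊ with hr
  set Γ : ℕ := ⌈4 * k / ε⌉₊ with hΓ
  have hn : (0 : ℝ) < n := by exact_mod_cast NeZero.pos n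
  have hc0 : 0 ≤ c := by positivity
  have hMc : c ≤ M := le_max_left _ _
  have hMn : n / k ≤ M := le_max_right _ _
  have hM0 : 0 < M := lt_of_lt_of_le (by positivity) hMn
  have hr1 : 64 * k / ε ^ 2 ≤ r := Nat.le_ceil _
  have hr0 : (0 : ℝ) < r := lt_of_lt_of_le (by positivity) hr1
  have hΓ1 : 4 * k / ε ≤ Γ := Nat.le_ceil _
  have hΓ0 : (0 : ℝ) < Γ := lt_of_lt_of_le (by positivity) hΓ1
  set p : Prog n ℝ := (do
    let u ← sampleVertex
    sampleBeta j Γ (G.avgDegree * Γ) u) with hp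
  have hev : ∀ f, ev adj.list 0 p f
      = (∑ u, ev adj.list 0 (sampleBeta j Γ (G.avgDegree * Γ) u) f) / n := by
    intro f
    simp [hp]
  set μ := ev adj.list 0 p id with hμ
  have hμ1 : n * μ ≤ c := by
    rw [hμ, hev, mul_div_cancel₀ _ hn.ne']
    simpa using sum_ev_sampleBeta_le (Γ := Γ) (D := G.avgDegree * Γ) (j := j) hu (f := id)
      (b := 1) zero_le_one rfl (by intro x _ _; simp)
  -- The choice Γ ≥ 4k/ε makes the bias 2n/Γ at most half of the permitted error; the other half is
  -- left for the fluctuations.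
  have hμ2 : c - ε * M / 2 ≤ n * μ := by
    rw [hμ, hev, mul_div_cancel₀ _ hn.ne']
    refine le_trans ?_ (le_sum_ev_sampleBeta (j := j) (by exact_mod_cast hΓ0) hu)
    have h1 : 2 * (n : ℝ) / Γ ≤ 2 * n / (4 * k / ε) := by gcongr
    have h2 : 2 * (n : ℝ) / (4 * k / ε) = ε * (n / k) / 2 := by
      field_simp
      ring
    have h3 : ε * (n / k) / 2 ≤ ε * M / 2 := by gcongr
    linarith
  have hsq : ev adj.list 0 p (fun x => x ^ 2) ≤ 2 * c / n := by
    rw [hev]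
    gcongr
    exact sum_ev_sampleBeta_le hu zero_le_two (by simp) fun x h0 h2 => by nlinarith
  have hvar := ev_replicate_sum_sq (adj := adj.list) r p hμ.symm hsq 0
  have hform : ev adj.list 0 (approxCC j ε k G.avgDegree)
      (fun x => if |x - c| ≤ ε * M then 0 else 1)
      = ev adj.list 0 (replicate r p) (fun l => if |(n : ℝ) / r * l.sum - c| ≤ ε * M
        then 0 else 1) := by
    simp only [approxCC, ev_bind, ev_doWork, ev_pure, zero_mul, zero_add]
    rfl
  rw [hform]
  -- Chebyshev's inequality: the failure indicator is at most the squared deviation from the mean,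
  -- measured in units of ε M / 2.
  have hind : ∀ l : List ℝ, (if |(n : ℝ) / r * l.sum - c| ≤ ε * M then (0 : ℝ) else 1)
      ≤ (2 * n / (r * (ε * M))) ^ 2 * (l.sum - r * μ + 0) ^ 2 := by
    intro l
    split_ifs with h
    · positivity
    · push Not at h
      have h1 : ε * M / 2 ≤ |(n : ℝ) / r * (l.sum - r * μ)| := by
        have h2 : (n : ℝ) / r * (l.sum - r * μ) = n / r * l.sum - n * μ := by
          field_simp
        rw [h2]
        rcases le_abs.1 h.le with h3 | h3
        · exact le_trans (by linarith [mul_pos hε hM0]) (le_abs_self _)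
        · exact le_trans (by linarith [mul_pos hε hM0]) (neg_le_abs _)
      have h2 : 1 ≤ |2 * n / (r * (ε * M)) * (l.sum - r * μ + 0)| := by
        have h3 : 2 * n / (r * (ε * M)) * (l.sum - r * μ + 0)
            = (n : ℝ) / r * (l.sum - r * μ) / (ε * M / 2) := by
          field_simp
          ring
        have h4 : 0 < ε * M / 2 := by positivity
        rw [h3, abs_div, abs_of_pos h4, one_le_div h4]
        exact h1
      rw [← mul_pow, ← sq_abs]
      exact one_le_pow₀ h2
  refine (ev_mono _ hind).trans ?_
  rw [ev_zero_mul]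
  calc (2 * n / (r * (ε * M))) ^ 2 * _
      ≤ (2 * n / (r * (ε * M))) ^ 2 * (0 ^ 2 + r * (2 * c / n)) := by gcongr
    _ = 8 * n * c / (r * (ε ^ 2 * M ^ 2)) := by
      field_simp
      ring
    _ ≤ 8 * n * c / (64 * k / ε ^ 2 * (ε ^ 2 * M ^ 2)) := by gcongr
    _ = n / k * c / (8 * M ^ 2) := by
      field_simp
      ring
    _ ≤ M * M / (8 * M ^ 2) := by gcongr
    _ = 1 / 8 := by
      field_simp

end

/-! ### The median -/

/-- The product of the weights is 2 to the number of failures minus the number of successes, stated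
without subtraction. -/
lemma prod_ite_two_half (P : ℝ → Prop) [DecidablePred P] (l : List ℝ) :
    (l.map fun x => if P x then (1 / 2 : ℝ) else 2).prod * 2 ^ l.countP (fun x => P x)
      = 2 ^ l.countP fun x => ¬ P x := by
  induction l with
  | nil => simp
  | cons a l ih =>
    by_cases h : P a
    · simp only [List.map_cons, List.prod_cons, h, if_true, List.countP_cons, decide_true,
        not_true_eq_false, decide_false, Bool.false_eq_true, if_false, add_zero, pow_succ]
      rw [← ih]
      ring
    · simp only [List.map_cons, List.prod_cons, h, if_true, List.countP_cons, decide_true,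
        not_false_eq_true, decide_false, Bool.false_eq_true, if_false, add_zero, pow_succ]
      rw [← ih]
      ring

/-- If the median misses an interval, then so do at least half of the elements. -/
lemma countP_le_of_median_notMem {l : List ℝ} (hl : l ≠ []) {P : ℝ → Prop} [DecidablePred P]
    (hP : ∀ x y z, P x → P z → x ≤ y → y ≤ z → P y) (h : ¬ P (median l)) :
    l.countP (fun x => P x) ≤ l.countP fun x => ¬ P x := by
  set s := l.insertionSort (· ≤ ·) with hs
  have hperm : s.Perm l := List.perm_insertionSort _ l
  have hsort : s.Pairwise (· ≤ ·) := List.pairwise_insertionSort _ l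
  have hlen : s.length = l.length := hperm.length_eq
  have hpos : 0 < l.length := List.length_pos_iff.2 hl
  set i := l.length / 2 with hi
  have his : i < s.length := by omega
  have hmed : median l = s[i] := by
    rw [median, ← hs, ← hi, List.getD_eq_getElem _ _ his]
  rw [hmed] at h
  rw [← hperm.countP_eq, ← hperm.countP_eq]
  have hmono : ∀ a b (ha : a < s.length) (hb : b < s.length), a ≤ b → s[a] ≤ s[b] := by
    intro a b ha hb hab
    rcases hab.eq_or_lt with rfl | hab
    · exact le_rfl
    · exact List.pairwise_iff_getElem.1 hsort a b ha hb hab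
  have htotal : s.countP (fun x => P x) + s.countP (fun x => ¬ P x) = s.length := by
    have := List.length_eq_countP_add_countP (fun x => decide (P x)) (l := s)
    rw [this]
    simp
  -- If P held on both sides of the middle index, it would hold at the median by convexity. Either
  -- side, the middle included, contains at least half of the list.
  have hmain : (∀ a (ha : a < s.length), a ≤ i → ¬ P s[a]) ∨
      ∀ a (ha : a < s.length), i ≤ a → ¬ P s[a] := by
    by_contra hcon
    push Not at hcon
    obtain ⟨⟨a, ha, hai, hPa⟩, b, hb, hib, hPb⟩ := hcon
    exact h (hP _ _ _ hPa hPb (hmono _ _ ha his hai) (hmono _ _ his hb hib))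
  rcases hmain with h1 | h1
  · have h2 : (s.take (i + 1)).countP (fun x => ¬ P x) = (s.take (i + 1)).length := by
      rw [List.countP_eq_length]
      intro x hx
      obtain ⟨a, ha, rfl⟩ := List.getElem_of_mem hx
      rw [List.length_take] at ha
      rw [List.getElem_take]
      simpa using h1 a (by omega) (by omega)
    have h3 := (List.take_sublist (i + 1) s).countP_le (p := fun x => decide (¬ P x))
    rw [h2, List.length_take] at h3
    omega
  · have h2 : (s.drop i).countP (fun x => ¬ P x) = (s.drop i).length := by
      rw [List.countP_eq_length]
      intro x hx
      obtain ⟨a, ha, rfl⟩ := List.getElem_of_mem hx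
      rw [List.length_drop] at ha
      rw [List.getElem_drop]
      simpa using h1 (i + a) (by omega) (by omega)
    have h3 := (List.drop_sublist i s).countP_le (p := fun x => decide (¬ P x))
    rw [h2, List.length_drop] at h3
    omega

/-- Boosting the success probability by taking the median. -/
lemma ev_replicate_median_le [NeZero n] {adj : Fin n → List (Fin n × ℕ)} {p : Prog n ℝ}
    {P : ℝ → Prop} [DecidablePred P]
    (hP : ∀ x y z, P x → P z → x ≤ y → y ≤ z → P y)
    (hp : ev adj 0 p (fun x => if P x then 0 else 1) ≤ 1 / 8) (m : ℕ) :
    ev adj 0 (replicate m p) (fun l => if P (median l) then 0 else 1) ≤ (11 / 16) ^ m := by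
  -- Chernoff's method: a failing median forces the product to be at least 1, while one factor has
  -- mean at most 1/2 · 7/8 + 2 · 1/8 = 11/16.
  have h1 : ∀ l : List ℝ, (if P (median l) then (0 : ℝ) else 1)
      ≤ (l.map fun x => if P x then (1 / 2 : ℝ) else 2).prod := by
    intro l
    have h0 : 0 ≤ (l.map fun x => if P x then (1 / 2 : ℝ) else 2).prod := by
      refine List.prod_nonneg fun x hx => ?_
      obtain ⟨y, -, rfl⟩ := List.mem_map.1 hx
      split_ifs <;> norm_num
    split_ifs with h
    · exact h0
    · rcases eq_or_ne l [] with rfl | hl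
      · simp
      · have h2 := prod_ite_two_half P l
        have h3 : (2 : ℝ) ^ l.countP (fun x => P x) ≤ 2 ^ l.countP fun x => ¬ P x :=
          pow_le_pow_right₀ one_le_two (countP_le_of_median_notMem hl hP h)
        rw [← h2] at h3
        exact le_of_mul_le_mul_right (by linarith) (by positivity :
          (0 : ℝ) < 2 ^ l.countP (fun x => P x))
  refine (ev_mono _ h1).trans ?_
  rw [ev_replicate_prod]
  have h2 : (fun x => if P x then (1 / 2 : ℝ) else 2)
      = fun x => 3 / 2 * (if P x then 0 else 1) + 1 / 2 := by
    funext x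
    split_ifs <;> norm_num
  have h3 : ev adj 0 p (fun x => if P x then (1 / 2 : ℝ) else 2) ≤ 11 / 16 := by
    rw [h2, ev_add_const, ev_zero_mul]
    linarith
  refine pow_le_pow_left₀ (ev_nonneg le_rfl _ fun x => ?_) h3 m
  split_ifs <;> norm_num

/-! ### The clamped median estimate -/

/-- `x` is an accurate estimate of the number of components of the subgraph of the edges of
weight at most `j`. -/
def GoodEstimate (G : WeightedGraph n W) (η : ℝ) (j : ℕ) (x : ℝ) : Prop :=
  1 ≤ x ∧ x ≤ n ∧ |x - G.numComponents j| ≤ η * max (G.numComponents j : ℝ) (n / √W)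

/-- Since 11/16 ≤ exp(-5/16), it suffices that 5C/16 ≥ 1; this is what `hC` is for. -/
lemma eleven_div_sixteen_pow_le {C : ℝ} (hC : 4 ≤ C) (hW : 1 ≤ W) :
    (11 / 16 : ℝ) ^ ⌈C * Real.log (1 / (1 / (4 * W)))⌉₊ ≤ 1 / (4 * W) := by
  have hW' : (1 : ℝ) ≤ W := by exact_mod_cast hW
  set m := ⌈C * Real.log (1 / (1 / (4 * W)))⌉₊
  have hm : C * Real.log (4 * W) ≤ m := by
    simp only [m, one_div_one_div]
    exact Nat.le_ceil _
  have hlog : 0 ≤ Real.log (4 * W) := Real.log_nonneg (by linarith)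
  have h1 : (11 / 16 : ℝ) ≤ Real.exp (-(5 / 16)) := by
    have := Real.add_one_le_exp (-(5 / 16) : ℝ)
    linarith
  calc (11 / 16 : ℝ) ^ m ≤ Real.exp (-(5 / 16)) ^ m := pow_le_pow_left₀ (by norm_num) h1 m
    _ = Real.exp (m * (-(5 / 16))) := by rw [Real.exp_nat_mul]
    _ ≤ Real.exp (-Real.log (4 * W)) := by
      apply Real.exp_le_exp.2
      nlinarith
    _ = 1 / (4 * W) := by
      rw [Real.exp_neg, Real.exp_log (by linarith), one_div]

/-- The true count lies in [1, n], so clamping to this interval cannot increase the error of the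
median. -/
lemma ev_componentEstimate_le [NeZero n] {adj : G.AdjLists} {j : ℕ}
    (hu : ∀ v, 0 < (adj.list v).length) (hW : 1 ≤ W) {C ε : ℝ} (hC : 4 ≤ C) (hε : 0 < ε)
    [DecidablePred (GoodEstimate G (ε / 8) j)] :
    ev adj.list 0 (componentEstimate C W G.avgDegree ε j)
      (fun x => if GoodEstimate G (ε / 8) j x then 0 else 1) ≤ 1 / (4 * W) := by
  classical
  have hWpos : (0 : ℝ) < W := by exact_mod_cast hW
  have hsqrt : 0 < √(W : ℝ) := Real.sqrt_pos.2 hWpos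
  have hmed := ev_replicate_median_le (adj := adj.list)
    (p := approxCC j (ε / 8) (√W) G.avgDegree)
    (P := fun x => |x - G.numComponents j| ≤ ε / 8 * max (G.numComponents j : ℝ) (n / √W))
    (by
      intro x y z hx hz hxy hyz
      rw [abs_le] at hx hz ⊢
      exact ⟨by linarith, by linarith⟩)
    (ev_approxCC_le hu (by positivity) hsqrt) ⌈C * Real.log (1 / (1 / (4 * W)))⌉₊
  refine le_trans ?_ (hmed.trans (eleven_div_sixteen_pow_le hC hW))
  simp only [componentEstimate, appNCCMedian, ev_bind, ev_doWork, ev_pure, zero_mul, zero_add]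
  refine ev_mono _ fun l => ?_
  by_cases h : |median l - G.numComponents j| ≤ ε / 8 * max (G.numComponents j : ℝ) (n / √W)
  · have hgood : GoodEstimate G (ε / 8) j (min (max (median l) 1) n) := by
      have hn1 : (1 : ℝ) ≤ n := by exact_mod_cast NeZero.pos n
      have h1 : (1 : ℝ) ≤ G.numComponents j := by exact_mod_cast G.one_le_numComponents j
      have h2 : (G.numComponents j : ℝ) ≤ n := by exact_mod_cast G.numComponents_le j
      refine ⟨le_min (le_max_right _ _) hn1, min_le_right _ _, le_trans ?_ h⟩
      rw [abs_le]
      constructor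
      · rcases le_total (median l) (G.numComponents j) with h3 | h3
        · rw [abs_of_nonpos (by linarith), neg_neg]
          have : median l ≤ min (max (median l) 1) n :=
            le_min (le_max_left _ _) (h3.trans h2)
          linarith
        · have h4 : (G.numComponents j : ℝ) ≤ min (max (median l) 1) n :=
            le_min (h3.trans (le_max_left _ _)) h2
          have := abs_nonneg (median l - G.numComponents j)
          linarith
      · rcases le_total (median l) (G.numComponents j) with h3 | h3
        · have h4 : min (max (median l) 1) (n : ℝ) ≤ G.numComponents j :=
            (min_le_left _ _).trans (max_le h3 h1)
          have := abs_nonneg (median l - G.numComponents j)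
          linarith
        · rw [abs_of_nonneg (by linarith)]
          have : min (max (median l) 1) (n : ℝ) ≤ median l :=
            (min_le_left _ _).trans (max_le le_rfl (h1.trans h3))
          linarith
    rw [if_pos hgood, if_pos h]
  · rw [if_neg h]
    split_ifs <;> norm_num

/-! ### Expected time of the estimates -/

/-- The cost of a search is proportional to the degree of its start, up to a constant; over a
uniform start the degree averages to d. -/
lemma ev_approxCC_time_le [NeZero n] {adj : G.AdjLists} (hu : ∀ v, 0 < (adj.list v).length)
    (j : ℕ) (ε k : ℝ) {R : ℕ} (hR : G.avgDegree * (⌈4 * k / ε⌉₊ : ℝ) ^ 2 < 2 ^ R) :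
    ev adj.list 1 (approxCC j ε k G.avgDegree) (fun _ => 0)
      ≤ 1 + ⌈64 * k / ε ^ 2⌉₊ * (7 + G.avgDegree * (2 + R)) := by
  have hn : (0 : ℝ) < n := by exact_mod_cast NeZero.pos n
  simp only [approxCC, ev_bind, ev_doWork, ev_pure]
  have h1 : ev adj.list 1 (do
      let u ← sampleVertex
      sampleBeta j ⌈4 * k / ε⌉₊ (G.avgDegree * ⌈4 * k / ε⌉₊) u) (fun _ => 0)
      ≤ 6 + G.avgDegree * (2 + R) := by
    simp only [ev_bind, ev_sampleVertex]
    have h2 : ∑ u, ev adj.list 1 (sampleBeta j ⌈4 * k / ε⌉₊ (G.avgDegree * ⌈4 * k / ε⌉₊) u)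
        (fun _ => 0) ≤ ∑ u, (5 + ((adj.list u).length : ℝ) * (2 + R)) :=
      Finset.sum_le_sum fun u _ => ev_sampleBeta_time_le (hu u) (by
        refine lt_of_eq_of_lt ?_ hR
        ring)
    rw [Finset.sum_add_distrib, ← Finset.sum_mul, sum_length] at h2
    simp only [sum_const, card_univ, Fintype.card_fin, nsmul_eq_mul] at h2
    have h3 := div_le_div_of_nonneg_right h2 hn.le
    have h4 : ((n : ℝ) * 5 + n * G.avgDegree * (2 + R)) / n = 5 + G.avgDegree * (2 + R) := by
      field_simp
    linarith
  have h2 := ev_replicate_time_le (adj := adj.list) ⌈64 * k / ε ^ 2⌉₊ _ h1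
  push_cast
  refine le_trans (le_of_eq ?_) (add_le_add_right (h2.trans_eq ?_) 1)
  · rw [one_mul]
  · ring

lemma ev_componentEstimate_time_le [NeZero n] {adj : G.AdjLists} (C ε : ℝ) (j : ℕ) {b : ℝ}
    (hb : ev adj.list 1 (approxCC j (ε / 8) (√W) G.avgDegree) (fun _ => 0) ≤ b) :
    ev adj.list 1 (componentEstimate C W G.avgDegree ε j) (fun _ => 0)
      ≤ ⌈C * Real.log (4 * W)⌉₊ * (1 + b) + ⌈C * Real.log (4 * W)⌉₊ ^ 2 + 2 := by
  simp only [componentEstimate, appNCCMedian, ev_bind, ev_doWork, ev_pure, one_div_one_div]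
  have h1 := ev_replicate_time_le (adj := adj.list) ⌈C * Real.log (4 * W)⌉₊ _ hb
  refine (ev_le_add _ fun _ => le_rfl).trans ?_
  push_cast
  linarith

/-! ### Binary search -/

/-- The result of the binary search with key `B` in the sequence `c`. -/
def detSearch (c : ℕ → ℝ) (B : ℝ) (l r : ℕ) : ℕ :=
  if _h : l < r then
    if c ((l + r) / 2) ≤ B then detSearch c B l ((l + r) / 2)
    else detSearch c B ((l + r) / 2 + 1) r
  else l
termination_by r - l
decreasing_by all_goals omega

section DetSearch

variable {c : ℕ → ℝ} {B : ℝ} {l r : ℕ}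

lemma detSearch_of_le (h : r ≤ l) : detSearch c B l r = l := by
  rw [detSearch, dif_neg (by omega)]

lemma detSearch_of_mid_le (h : l < r) (hc : c ((l + r) / 2) ≤ B) :
    detSearch c B l r = detSearch c B l ((l + r) / 2) := by
  rw [detSearch, dif_pos h, if_pos hc]

lemma detSearch_of_lt_mid (h : l < r) (hc : ¬ c ((l + r) / 2) ≤ B) :
    detSearch c B l r = detSearch c B ((l + r) / 2 + 1) r := by
  rw [detSearch, dif_pos h, if_neg hc]

/-- The sequence need not be monotone: the search only ever moves its right end to a point with
value ≤ B and its left end just past a point with value > B. -/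
lemma detSearch_spec (h : l ≤ r) :
    l ≤ detSearch c B l r ∧ detSearch c B l r ≤ r ∧
      (detSearch c B l r < r → c (detSearch c B l r) ≤ B) ∧
      (l < detSearch c B l r → B < c (detSearch c B l r - 1)) := by
  induction hk : r - l using Nat.strong_induction_on generalizing l r with
  | _ k ih =>
    rcases h.eq_or_lt with rfl | h
    · rw [detSearch_of_le le_rfl]
      simp
    · by_cases hc : c ((l + r) / 2) ≤ B
      · rw [detSearch_of_mid_le h hc]
        obtain ⟨h1, h2, h3, h4⟩ := ih ((l + r) / 2 - l) (by omega) (l := l)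
          (r := (l + r) / 2) (by omega) rfl
        refine ⟨h1, by omega, fun _ => ?_, h4⟩
        rcases h2.eq_or_lt with h5 | h5
        · rwa [h5]
        · exact h3 h5
      · rw [detSearch_of_lt_mid h hc]
        obtain ⟨h1, h2, h3, h4⟩ := ih (r - ((l + r) / 2 + 1)) (by omega)
          (l := (l + r) / 2 + 1) (r := r) (by omega) rfl
        refine ⟨by omega, h2, h3, fun _ => ?_⟩
        rcases h1.eq_or_lt with h5 | h5
        · rw [← h5, Nat.add_sub_cancel]
          exact not_le.1 hc
        · exact h4 h5

/-- Both searches probe the same midpoints until they part; there the larger key goes left and the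
smaller one right. No monotonicity of c is involved. -/
lemma detSearch_antitone {B' : ℝ} (hB : B' ≤ B) (h : l ≤ r) :
    detSearch c B l r ≤ detSearch c B' l r := by
  induction hk : r - l using Nat.strong_induction_on generalizing l r with
  | _ k ih =>
    rcases h.eq_or_lt with rfl | h
    · rw [detSearch_of_le le_rfl, detSearch_of_le le_rfl]
    · by_cases hc' : c ((l + r) / 2) ≤ B'
      · rw [detSearch_of_mid_le h hc', detSearch_of_mid_le h (hc'.trans hB)]
        exact ih _ (by omega) (by omega) rfl
      · rw [detSearch_of_lt_mid h hc']
        by_cases hc : c ((l + r) / 2) ≤ B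
        · rw [detSearch_of_mid_le h hc]
          have h1 := (detSearch_spec (c := c) (B := B) (l := l) (r := (l + r) / 2)
            (by omega)).2.1
          have h2 := (detSearch_spec (c := c) (B := B') (l := (l + r) / 2 + 1) (r := r)
            (by omega)).1
          omega
        · rw [detSearch_of_lt_mid h hc]
          exact ih _ (by omega) (by omega) rfl

end DetSearch

/-! ### Binary search on random estimates -/

section Search

variable {n : ℕ} [NeZero n] {adj : Fin n → List (Fin n × ℕ)} {est : ℕ → Prog n ℝ}

/-- The sequence `c` agrees with the stored estimates. -/
def Extends (c : ℕ → ℝ) (T : Table) : Prop := ∀ m x, T m = some x → c m = x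

/-- The number of estimates that may still be requested. -/
def missing (W : ℕ) (T : Table) : ℕ := #{m ∈ Ico 1 W | T m = none}

omit [NeZero n] in
lemma missing_update {W m : ℕ} {T : Table} (hm : m ∈ Ico 1 W) (hT : T m = none) (x : ℝ) :
    missing W (Function.update T m (some x)) + 1 = missing W T := by
  have h1 : {k ∈ Ico 1 W | Function.update T m (some x) k = none}
      = {k ∈ Ico 1 W | T k = none}.erase m := by
    ext k
    by_cases hk : k = m
    · subst hk
      simp
    · simp [hk]
  rw [missing, h1, missing, card_erase_add_one (mem_filter.2 ⟨hm, hT⟩)]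

lemma ev_zero_le_one {α : Type} (p : Prog n α) {f : α → ℝ} (hf : ∀ a, f a ≤ 1) :
    ev adj 0 p f ≤ 1 :=
  (ev_mono p hf).trans_eq (ev_zero_const p 1)

open Classical in
/-- If every estimate is good with probability at least `1 - δ`, then, up to a failure
probability of `δ` for each missing estimate, the search returns what it returns on a
fixed sequence. -/
lemma ev_binarySearch_le {good : ℕ → ℝ → Prop} {δ : ℝ} (hδ : 0 ≤ δ) {W : ℕ}
    (hest : ∀ m ∈ Ico 1 W, ev adj 0 (est m) (fun x => if good m x then 0 else 1) ≤ δ) {B : ℝ}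
    {l r : ℕ} {T : Table} (hl : 1 ≤ l) (hr : r ≤ W) (hT : ∀ m x, T m = some x → good m x)
    {g : ℕ × Table → ℝ} (hg1 : ∀ y, g y ≤ 1)
    (hg : ∀ i T', (∀ m x, T' m = some x → good m x) → (∀ c, Extends c T' → Extends c T) →
      (∀ c, Extends c T' → detSearch c B l r = i) → g (i, T') ≤ δ * missing W T') :
    ev adj 0 (binarySearch est B l r T) g ≤ δ * missing W T := by
  induction hk : r - l using Nat.strong_induction_on generalizing l r T with
  | _ k ih =>
  rw [binarySearch]
  by_cases h : l < r
  swap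
  · rw [dif_neg h, ev_pure]
    exact hg l T hT (fun _ hc => hc) fun c _ => detSearch_of_le (by omega)
  rw [dif_pos h, ev_bind]
  set m := (l + r) / 2 with hm
  -- A midpoint is strictly below r ≤ W, so the estimate for W itself is never requested.
  have hmW : m ∈ Ico 1 W := mem_Ico.2 ⟨by omega, by omega⟩
  -- Once the value at m is stored, every sequence extending a later table has this value at m and
  -- sends the deterministic search into the same branch.
  have key : ∀ x T', T' m = some x → (∀ m x, T' m = some x → good m x) →
      (∀ c, Extends c T' → Extends c T) →
      ev adj 0 (if x ≤ B then binarySearch est B l m T' else binarySearch est B (m + 1) r T') g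
        ≤ δ * missing W T' := by
    intro x T' hx hT' hext
    split_ifs with hxB
    · refine ih (m - l) (by omega) hl (by omega) hT' (fun i T'' h1 h2 h3 => ?_) rfl
      refine hg i T'' h1 (fun c hc => hext c (h2 c hc)) fun c hc => ?_
      rw [detSearch_of_mid_le h (by rw [← hm, h2 c hc m x hx]; exact hxB)]
      exact h3 c hc
    · refine ih (r - (m + 1)) (by omega) (by omega) hr hT' (fun i T'' h1 h2 h3 => ?_) rfl
      refine hg i T'' h1 (fun c hc => hext c (h2 c hc)) fun c hc => ?_
      rw [detSearch_of_lt_mid h (by rw [← hm, h2 c hc m x hx]; exact hxB)]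
      exact h3 c hc
  simp only [getEst, ev_bind, ev_doWork, zero_mul, zero_add]
  rcases hTm : T m with _ | x
  · simp only [ev_bind, ev_pure]
    have hmiss : ∀ x, (missing W (Function.update T m (some x)) : ℝ) = missing W T - 1 := by
      intro x
      rw [← missing_update hmW hTm x]
      push_cast
      ring
    have hmiss1 : (1 : ℝ) ≤ missing W T := by
      rw [← missing_update hmW hTm 0]
      push_cast
      have : (0 : ℝ) ≤ missing W (Function.update T m (some 0)) := by positivity
      linarith
    -- A new estimate uses up one missing entry, which frees δ; this pays for the event that it is
    -- bad, where the payoff is bounded by 1.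
    have hpt : ∀ x, ev adj 0 (if x ≤ B then binarySearch est B l m (Function.update T m (some x))
        else binarySearch est B (m + 1) r (Function.update T m (some x))) g
        ≤ (if good m x then 0 else 1) + δ * (missing W T - 1) := by
      intro x
      by_cases hx : good m x
      · rw [if_pos hx, zero_add, ← hmiss x]
        refine key x _ (Function.update_self _ _ _) ?_ ?_
        · intro k y hy
          by_cases hkm : k = m
          · subst hkm
            rw [Function.update_self, Option.some.injEq] at hy
            rwa [← hy]
          · rw [Function.update_of_ne hkm] at hy
            exact hT k y hy
        · intro c hc k y hy
          refine hc k y ?_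
          rw [Function.update_of_ne, hy]
          rintro rfl
          rw [hTm] at hy
          exact absurd hy (by simp)
      · rw [if_neg hx]
        have h1 := ev_zero_le_one (adj := adj)
          (if x ≤ B then binarySearch est B l m (Function.update T m (some x))
            else binarySearch est B (m + 1) r (Function.update T m (some x))) hg1
        have h2 : 0 ≤ δ * (missing W T - 1) := mul_nonneg hδ (by linarith)
        linarith
    refine (ev_mono _ hpt).trans ?_
    rw [ev_add_const]
    linarith [hest m hmW]
  · simp only [ev_pure]
    exact key x T hTm hT fun _ hc => hc

open Classical in
/-- All searches return what they return on a fixed sequence of good estimates. -/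
lemma ev_searchAll_le {good : ℕ → ℝ → Prop} (hgood : ∀ m, ∃ x, good m x) {δ : ℝ} (hδ : 0 ≤ δ)
    {W : ℕ} (hest : ∀ m ∈ Ico 1 W, ev adj 0 (est m) (fun x => if good m x then 0 else 1) ≤ δ)
    (Bs : List ℝ) {T : Table} (hT : ∀ m x, T m = some x → good m x) :
    ev adj 0 (searchAll est W Bs T) (fun js =>
      if ∃ c, (∀ m, good m (c m)) ∧ Extends c T ∧ js = Bs.map fun B => detSearch c B 1 W
        then 0 else 1) ≤ δ * missing W T := by
  induction Bs generalizing T with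
  | nil =>
    choose x hx using hgood
    have h : ∃ c, (∀ m, good m (c m)) ∧ Extends c T ∧
        ([] : List ℕ) = [].map fun B => detSearch c B 1 W := by
      -- The sequence is chosen only after all searches: stored estimates where they exist,
      -- arbitrary good values elsewhere.
      refine ⟨fun m => (T m).getD (x m), fun m => ?_, fun m y hy => by simp [hy], rfl⟩
      rcases hm : T m with _ | y
      · simpa [hm] using hx m
      · simpa [hm] using hT m y hm
    rw [searchAll, ev_pure, if_pos h]
    positivity
  | cons B Bs ih =>
    simp only [searchAll, ev_bind, ev_doWork, ev_pure, zero_mul, zero_add]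
    refine ev_binarySearch_le hδ hest le_rfl le_rfl hT ?_ ?_
    · intro y
      refine ev_zero_le_one _ fun js => ?_
      split_ifs <;> norm_num
    · intro i T' hT' hext hi
      refine le_trans (ev_mono _ fun js => ?_) (ih hT')
      by_cases h : ∃ c, (∀ m, good m (c m)) ∧ Extends c T' ∧
          js = Bs.map fun B => detSearch c B 1 W
      · rw [if_pos h, if_pos]
        obtain ⟨c, h1, h2, h3⟩ := h
        exact ⟨c, h1, hext c h2, by rw [List.map_cons, hi c h2, h3]⟩
      · rw [if_neg h]
        split_ifs <;> norm_num

/-- Stored values are charged as if they were recomputed; the table matters for consistency and the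
union bound, not for this time bound. -/
lemma ev_getEst_time_le {b e : ℝ} (he : ∀ m, ev adj 1 (est m) (fun _ => 0) ≤ e)
    (he0 : 0 ≤ e) (m : ℕ) (T : Table) {f : ℝ × Table → ℝ} (hf : ∀ y, f y ≤ b) :
    ev adj 1 (getEst est m T) f ≤ 1 + e + b := by
  simp only [getEst, ev_bind, ev_doWork]
  rcases T m with _ | x
  · simp only [ev_bind, ev_pure]
    have := ev_le_add (adj := adj) (τ := 1) (est m)
      (f := fun x => f (x, Function.update T m (some x))) fun x => hf _
    push_cast
    linarith [he m]
  · simp only [ev_pure]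
    push_cast
    linarith [hf (x, T)]

lemma ev_binarySearch_time_le {b e : ℝ} (he : ∀ m, ev adj 1 (est m) (fun _ => 0) ≤ e)
    (he0 : 0 ≤ e) (B : ℝ) {s l r : ℕ} (hs : r - l < 2 ^ s) (T : Table)
    {f : ℕ × Table → ℝ} (hf : ∀ y, f y ≤ b) :
    ev adj 1 (binarySearch est B l r T) f ≤ s * (1 + e) + b := by
  induction s generalizing l r T with
  | zero =>
    rw [binarySearch, dif_neg (by simp at hs; omega), ev_pure]
    simpa using hf _
  | succ s ih =>
    rw [binarySearch]
    have h0 : (0 : ℝ) ≤ s * (1 + e) := by positivity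
    rw [pow_succ] at hs
    split_ifs with h
    · rw [ev_bind]
      refine (ev_getEst_time_le he he0 _ T (b := s * (1 + e) + b) fun y => ?_).trans
        (le_of_eq ?_)
      · obtain ⟨x, T'⟩ := y
        simp only
        split_ifs
        · exact ih (by omega) T'
        · exact ih (by omega) T'
      · push_cast
        ring
    · rw [ev_pure]
      push_cast
      linarith [hf (l, T)]

lemma ev_searchAll_time_le {e : ℝ} (he : ∀ m, ev adj 1 (est m) (fun _ => 0) ≤ e)
    (he0 : 0 ≤ e) {W s : ℕ} (hs : W - 1 < 2 ^ s) (Bs : List ℝ) (T : Table) :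
    ev adj 1 (searchAll est W Bs T) (fun _ => 0) ≤ Bs.length * (1 + s * (1 + e)) := by
  induction Bs generalizing T with
  | nil => simp [searchAll]
  | cons B Bs ih =>
    simp only [searchAll, ev_bind, ev_doWork, ev_pure]
    have := ev_binarySearch_time_le he he0 B hs T
      (f := fun y => ev adj 1 (searchAll est W Bs y.2) fun _ => 0) fun y => ih y.2
    rw [List.length_cons]
    push_cast
    linarith

end Search

/-! ### Accuracy of the interval approximation -/

section Accuracy

variable {n W t : ℕ} {e x : ℝ} {c ĉ B : ℕ → ℝ}

/-- In the interval between two consecutive search results, the sequence is close to the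
interval endpoint. -/
lemma abs_sub_endpoint_le (he : 0 < e) (he1 : e ≤ 1 / 102) (hc : Antitone c)
    (hx : 0 < x) (hĉ : ∀ j, |ĉ j - c j| ≤ e / 8 * max (c j) x) (hc1 : ∀ j, 1 ≤ c j)
    {b b' : ℝ} (hgap : b - b' ≤ 2 * e * max b' x) {j k k' : ℕ} (hk : ĉ k ≤ b) (hkj : k ≤ j)
    (hk' : b' < ĉ k') (hjk : j ≤ k') :
    |c j - b| ≤ 3 * e * max (c j) x := by
  set M := max (c j) x with hM
  have hcM : c j ≤ M := le_max_left _ _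
  have hxM : x ≤ M := le_max_right _ _
  have hM0 : 0 < M := hx.trans_le hxM
  have hl := (abs_le.1 (hĉ k')).2
  have hmono : max (c k') x ≤ M := max_le_max_right _ (hc hjk)
  have h1 : b' ≤ c j + e / 8 * M := by
    have := hc hjk
    have : e / 8 * max (c k') x ≤ e / 8 * M := by gcongr
    linarith
  have h2 : max b' x ≤ (1 + e / 8) * M := by
    refine max_le ?_ ?_ <;> nlinarith
  have h3 : b ≤ c j + 3 * e * M := by
    have h4 : 2 * e * max b' x ≤ 2 * e * ((1 + e / 8) * M) := by gcongr
    nlinarith [mul_pos he hM0]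
  have hu := (abs_le.1 (hĉ k)).1
  have h5 := hc hkj
  rw [abs_le]
  refine ⟨by linarith, ?_⟩
  -- As k ≤ j, c k may exceed M; its error term is controlled through the key, c k ≤ 2b ≤ 4M.
  rcases le_total (c k) x with h6 | h6
  · rw [max_eq_right h6] at hu
    have : e / 8 * x ≤ e / 8 * M := by gcongr
    nlinarith [mul_pos he hM0]
  · rw [max_eq_left h6] at hu
    have h7 : c k ≤ 2 * b := by nlinarith [hc1 k]
    have h8 : b ≤ 2 * M := by nlinarith [mul_pos he hM0]
    nlinarith [mul_pos he hM0]

/-- The difference factors as (b - a)(a + b - 1), with second factor at most 3 max(a, x). The term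
x² stays separate because summed over fewer than W indices it is at most W x² = n². -/
lemma abs_sq_sub_self_sub_le (he : 0 < e) (he1 : e ≤ 1 / 102) (hx : 0 < x) {a b : ℝ}
    (ha : 1 ≤ a) (hb : 0 ≤ b) (h : |a - b| ≤ 3 * e * max a x) :
    |b ^ 2 - b - (a ^ 2 - a)| ≤ 9 * e * (a ^ 2 + x ^ 2) := by
  set M := max a x with hM
  have haM : a ≤ M := le_max_left _ _
  have hM0 : 0 < M := hx.trans_le (le_max_right _ _)
  have hM2 : M ^ 2 ≤ a ^ 2 + x ^ 2 := by
    rcases max_choice a x with h1 | h1 <;> rw [hM, h1] <;> nlinarith [sq_nonneg a, sq_nonneg x]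
  have hbM : b ≤ 2 * M := by
    have := (abs_le.1 h).1
    nlinarith [mul_pos he hM0]
  have h1 : b ^ 2 - b - (a ^ 2 - a) = -((a - b) * (a + b - 1)) := by ring
  rw [h1, abs_neg, abs_mul]
  calc |a - b| * |a + b - 1| ≤ 3 * e * M * (3 * M) := by
        gcongr
        rw [abs_of_nonneg (by linarith)]
        linarith
    _ = 9 * e * M ^ 2 := by ring
    _ ≤ _ := by gcongr

/-- The accuracy of the cost estimate that is obtained from good estimates of the numbers of
components. -/
lemma abs_estimate_sub_le (hn : 2 ≤ n) (he : 0 < e) (he1 : e ≤ 1 / 102) (hx : 0 < x)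
    (hW : 1 ≤ W) (hWx2 : W * x ^ 2 = (n : ℝ) ^ 2) (hWx : W * x ≤ (n : ℝ) ^ 2)
    (hWn : (W : ℝ) ≤ n ^ 2)
    (hc : Antitone c) (hc1 : ∀ j, 1 ≤ c j) (hĉn : ∀ j, ĉ j ≤ n)
    (hĉ : ∀ j, |ĉ j - c j| ≤ e / 8 * max (c j) x)
    (ht : 1 ≤ t) (hB1 : B 1 = n) (hBmono : ∀ i, 1 ≤ i → i < t → B (i + 1) ≤ B i)
    (hgap : ∀ i, 1 ≤ i → i < t → B i - B (i + 1) ≤ 2 * e * max (B (i + 1)) x)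
    (hBpos : ∀ i, 1 ≤ i → i ≤ t → 0 ≤ B i) (hBt : B t ≤ 2 * e * x) {J : ℕ → ℕ}
    (hJ : ∀ i, J i = detSearch ĉ (B i) 1 W) :
    |∑ i ∈ Icc 1 t, ((J (i + 1) : ℝ) - J i) * (B i ^ 2 - B i)
        - ∑ j ∈ Ico 1 W, (c j ^ 2 - c j)|
      ≤ e * (18 * ∑ j ∈ Ico 1 W, (c j ^ 2 - c j) + 21 * n ^ 2) := by
  have hspec : ∀ i, 1 ≤ J i ∧ J i ≤ W ∧ (J i < W → ĉ (J i) ≤ B i) ∧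
      (1 < J i → B i < ĉ (J i - 1)) := by
    intro i
    rw [hJ]
    exact detSearch_spec hW
  have hJmono : ∀ i, 1 ≤ i → i < t → J i ≤ J (i + 1) := by
    intro i h1 h2
    rw [hJ, hJ]
    exact detSearch_antitone (hBmono i h1 h2) hW
  have hJ1 : J 1 = 1 := by
    have h1 := hspec 1
    by_contra hne
    have := h1.2.2.2 (by omega)
    rw [hB1] at this
    linarith [hĉn (J 1 - 1)]
  have main : ∀ k, 1 ≤ k → k ≤ t →
      |∑ i ∈ Ico 1 k, ((J (i + 1) : ℝ) - J i) * (B i ^ 2 - B i)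
        - ∑ j ∈ Ico 1 (J k), (c j ^ 2 - c j)| ≤ 9 * e * ∑ j ∈ Ico 1 (J k), (c j ^ 2 + x ^ 2) := by
    intro k hk1
    induction k, hk1 using Nat.le_induction with
    | base => simp [hJ1]
    | succ k hk1 ih =>
      intro hkt
      have ih := ih (by omega)
      have hmono := hJmono k hk1 (by omega)
      rw [Finset.sum_Ico_succ_top hk1, ← Finset.sum_Ico_consecutive _ (hspec k).1 hmono,
        ← Finset.sum_Ico_consecutive (fun j => c j ^ 2 + x ^ 2) (hspec k).1 hmono]
      have h1 : ((J (k + 1) : ℝ) - J k) * (B k ^ 2 - B k)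
          = ∑ _j ∈ Ico (J k) (J (k + 1)), (B k ^ 2 - B k) := by
        rw [sum_const, Nat.card_Ico, nsmul_eq_mul, Nat.cast_sub hmono]
      have h2 : |∑ j ∈ Ico (J k) (J (k + 1)), ((B k ^ 2 - B k) - (c j ^ 2 - c j))|
          ≤ ∑ j ∈ Ico (J k) (J (k + 1)), 9 * e * (c j ^ 2 + x ^ 2) := by
        refine (Finset.abs_sum_le_sum_abs _ _).trans (Finset.sum_le_sum fun j hj => ?_)
        rw [mem_Ico] at hj
        have hJk := hspec k
        have hJk' := hspec (k + 1)
        -- An index j in this range forces J k < W and 1 < J (k + 1), so both comparisons of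
        -- `detSearch_spec` are available, the second one at J (k + 1) - 1 ≥ j.
        exact abs_sq_sub_self_sub_le he he1 hx (hc1 j) (hBpos k hk1 (by omega))
          (abs_sub_endpoint_le he he1 hc hx hĉ hc1 (hgap k hk1 (by omega))
            (hJk.2.2.1 (by omega)) hj.1 (hJk'.2.2.2 (by omega)) (by omega))
      rw [Finset.sum_sub_distrib, ← h1, ← Finset.mul_sum] at h2
      rw [mul_add]
      refine le_trans (le_of_eq ?_) ((abs_add_le _ _).trans (add_le_add ih h2))
      congr 1
      ring
  have hm := main t ht le_rfl
  have hgnn : ∀ j, 0 ≤ c j ^ 2 - c j := fun j => by nlinarith [hc1 j]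
  have hZ : ∑ j ∈ Ico 1 W, (c j ^ 2 - c j)
      = ∑ j ∈ Ico 1 (J t), (c j ^ 2 - c j) + ∑ j ∈ Ico (J t) W, (c j ^ 2 - c j) :=
    (Finset.sum_Ico_consecutive _ (hspec t).1 (hspec t).2.1).symm
  have htail0 : 0 ≤ ∑ j ∈ Ico (J t) W, (c j ^ 2 - c j) := Finset.sum_nonneg fun j _ => hgnn j
  -- Beyond J t the key B t ≤ 2ex forces c j ≤ 3ex, so omitting these terms costs at most 9 e² W x².
  have htail : ∑ j ∈ Ico (J t) W, (c j ^ 2 - c j) ≤ 9 * e ^ 2 * n ^ 2 := by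
    calc ∑ j ∈ Ico (J t) W, (c j ^ 2 - c j) ≤ ∑ _j ∈ Ico (J t) W, 9 * e ^ 2 * x ^ 2 := by
          refine Finset.sum_le_sum fun j hj => ?_
          rw [mem_Ico] at hj
          have h1 := (hspec t).2.2.1 (by omega)
          have h2 := (abs_le.1 (hĉ (J t))).1
          have h3 := hc hj.1
          have hex := mul_pos he hx
          have h4 : c (J t) ≤ 3 * e * x := by
            rcases le_total (c (J t)) x with h5 | h5
            · rw [max_eq_right h5] at h2
              linarith
            · rw [max_eq_left h5] at h2
              nlinarith
          have h5 := hc1 j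
          have h6 : c j ≤ 3 * e * x := h3.trans h4
          nlinarith
      _ = ((W - J t : ℕ) : ℝ) * (9 * e ^ 2 * x ^ 2) := by
          rw [sum_const, Nat.card_Ico, nsmul_eq_mul]
      _ ≤ W * (9 * e ^ 2 * x ^ 2) := by
          gcongr
          omega
      _ = 9 * e ^ 2 * (W * x ^ 2) := by ring
      _ = _ := by rw [hWx2]
  -- No accuracy is claimed for the last summand, as nothing is assumed about B (t + 1): the index
  -- difference is at most W and B t is small.
  have hlast : |((J (t + 1) : ℝ) - J t) * (B t ^ 2 - B t)| ≤ (4 * e ^ 2 + 2 * e) * n ^ 2 := by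
    have h0 := hBpos t ht le_rfl
    have h1 : |(J (t + 1) : ℝ) - J t| ≤ W := by
      have h2 : (J (t + 1) : ℝ) ≤ W := by exact_mod_cast (hspec (t + 1)).2.1
      have h3 : (J t : ℝ) ≤ W := by exact_mod_cast (hspec t).2.1
      rw [abs_le]
      constructor <;> linarith [(Nat.cast_nonneg (J t) : (0 : ℝ) ≤ J t),
        (Nat.cast_nonneg (J (t + 1)) : (0 : ℝ) ≤ J (t + 1))]
    have h2 : |B t ^ 2 - B t| ≤ 4 * e ^ 2 * x ^ 2 + 2 * e * x := by
      have hex := mul_pos he hx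
      rw [abs_le]
      constructor <;> nlinarith
    rw [abs_mul]
    calc _ ≤ (W : ℝ) * (4 * e ^ 2 * x ^ 2 + 2 * e * x) := by gcongr
      _ = 4 * e ^ 2 * (W * x ^ 2) + 2 * e * (W * x) := by ring
      _ ≤ 4 * e ^ 2 * n ^ 2 + 2 * e * n ^ 2 := by
        rw [hWx2]
        gcongr
      _ = _ := by ring
  have hsq : ∑ j ∈ Ico 1 (J t), (c j ^ 2 + x ^ 2)
      ≤ 2 * ∑ j ∈ Ico 1 W, (c j ^ 2 - c j) + 2 * n ^ 2 := by
    calc ∑ j ∈ Ico 1 (J t), (c j ^ 2 + x ^ 2) ≤ ∑ j ∈ Ico 1 W, (c j ^ 2 + x ^ 2) :=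
          Finset.sum_le_sum_of_subset_of_nonneg (Ico_subset_Ico_right (hspec t).2.1)
            fun j _ _ => by positivity
      _ ≤ ∑ j ∈ Ico 1 W, (2 * (c j ^ 2 - c j) + (1 + x ^ 2)) :=
          Finset.sum_le_sum fun j _ => by nlinarith [sq_nonneg (c j - 1)]
      _ = 2 * ∑ j ∈ Ico 1 W, (c j ^ 2 - c j) + ((W - 1 : ℕ) : ℝ) * (1 + x ^ 2) := by
          rw [sum_add_distrib, ← mul_sum, sum_const, Nat.card_Ico, nsmul_eq_mul]
      _ ≤ 2 * ∑ j ∈ Ico 1 W, (c j ^ 2 - c j) + W * (1 + x ^ 2) := by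
          gcongr
          omega
      _ ≤ _ := by nlinarith
  have hn2 : (0 : ℝ) < (n : ℝ) ^ 2 := by positivity
  have hZ0 : 0 ≤ ∑ j ∈ Ico 1 W, (c j ^ 2 - c j) := Finset.sum_nonneg fun j _ => hgnn j
  rw [← Finset.Ico_add_one_right_eq_Icc, Finset.sum_Ico_succ_top ht]
  rw [abs_le] at hm hlast ⊢
  -- The coefficient of e n² is 18 from here, 2 from the last summand, and less than 1 from the
  -- terms in e², as e ≤ 1/102; hence 21.
  have h9 : 9 * e * ∑ j ∈ Ico 1 (J t), (c j ^ 2 + x ^ 2)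
      ≤ 9 * e * (2 * ∑ j ∈ Ico 1 W, (c j ^ 2 - c j) + 2 * n ^ 2) := by gcongr
  have he2 : e ^ 2 * (n : ℝ) ^ 2 ≤ 1 / 102 * (e * n ^ 2) := by
    rw [sq e, mul_assoc]
    gcongr
  have hen : 0 < e * (n : ℝ) ^ 2 := by positivity
  constructor <;> linarith

end Accuracy

/-! ### The interval endpoints -/

section Endpoints

variable {n W : ℕ} {e : ℝ}

lemma one_le_t₁ (hW : 1 ≤ W) (he : 0 < e) : 1 ≤ t₁ W e := by
  have hs : 1 ≤ √(W : ℝ) := Real.one_le_sqrt.2 (by exact_mod_cast hW)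
  refine Nat.le_floor ?_
  have := Real.logb_nonneg (b := 1 + e) (by linarith) hs
  push_cast
  linarith

/-- Together with `lt_pow_t₁` this places the last geometric endpoint between n/√W and (1 + e) n/√W.
-/
lemma pow_t₁_le (hW : 1 ≤ W) (he : 0 < e) : (1 + e) ^ (t₁ W e - 1) ≤ √(W : ℝ) := by
  have hs : 1 ≤ √(W : ℝ) := Real.one_le_sqrt.2 (by exact_mod_cast hW)
  have h1 : 1 ≤ t₁ W e := one_le_t₁ hW he
  have h0 := Real.logb_nonneg (b := 1 + e) (by linarith) hs
  have h2 : (t₁ W e : ℝ) ≤ Real.logb (1 + e) (√W) + 1 := Nat.floor_le (by linarith)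
  rw [← Real.rpow_natCast, ← Real.le_logb_iff_rpow_le (by linarith) (by linarith),
    Nat.cast_sub h1]
  push_cast
  linarith

lemma lt_pow_t₁ (hW : 1 ≤ W) (he : 0 < e) : √(W : ℝ) < (1 + e) ^ t₁ W e := by
  have hs : 1 ≤ √(W : ℝ) := Real.one_le_sqrt.2 (by exact_mod_cast hW)
  have h2 : Real.logb (1 + e) (√W) + 1 < t₁ W e + 1 := Nat.lt_floor_add_one _
  rw [← Real.rpow_natCast, ← Real.logb_lt_iff_lt_rpow (by linarith) (by linarith)]
  linarith

lemma t₂_le (he : 0 < e) (he1 : e ≤ 1) : (t₂ e : ℝ) ≤ 1 / e - 1 := by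
  refine Nat.floor_le ?_
  rw [sub_nonneg, one_le_div he]
  exact he1

lemma lt_t₂ : 1 / e - 2 < t₂ e := by
  have : 1 / e - 1 < t₂ e + 1 := Nat.lt_floor_add_one _
  linarith

lemma one_le_t₂ (he : 0 < e) (he1 : e ≤ 1 / 102) : 1 ≤ t₂ e := by
  refine Nat.le_floor ?_
  have : 2 ≤ 1 / e := by
    rw [le_div_iff₀ he]
    linarith
  push_cast
  linarith

lemma endpoint_one (hW : 1 ≤ W) (he : 0 < e) : endpoint n W e 1 = n := by
  rw [endpoint, if_pos (one_le_t₁ hW he)]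
  simp

lemma endpoint_of_le {i : ℕ} (hi : i ≤ t₁ W e) :
    endpoint n W e i = n / (1 + e) ^ (i - 1) := by
  rw [endpoint, if_pos hi]

lemma endpoint_of_lt {i : ℕ} (hi : t₁ W e < i) (hi' : i ≤ t₁ W e + t₂ e) :
    endpoint n W e i = n / √W * (1 - e * ((i : ℝ) - t₁ W e)) := by
  rw [endpoint, if_neg (by omega), if_pos hi']

lemma endpoint_nonneg (he : 0 < e) (he1 : e ≤ 1) {i : ℕ} (hi : i ≤ t₁ W e + t₂ e) :
    0 ≤ endpoint n W e i := by
  rcases le_or_gt i (t₁ W e) with h | h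
  · rw [endpoint_of_le h]
    positivity
  · rw [endpoint_of_lt h hi]
    refine mul_nonneg (by positivity) ?_
    have h1 : (i : ℝ) - t₁ W e ≤ t₂ e := by
      have : (i : ℝ) ≤ t₁ W e + t₂ e := by exact_mod_cast hi
      linarith
    have h2 : e * ((i : ℝ) - t₁ W e) ≤ e * (1 / e - 1) :=
      mul_le_mul_of_nonneg_left (h1.trans (t₂_le he he1)) he.le
    have h3 : e * (1 / e - 1) = 1 - e := by field_simp
    linarith

/-- Consecutive interval endpoints are close. -/
lemma endpoint_succ (hW : 1 ≤ W) (he : 0 < e) {i : ℕ} (hi1 : 1 ≤ i)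
    (hi : i < t₁ W e + t₂ e) :
    endpoint n W e (i + 1) ≤ endpoint n W e i ∧
      endpoint n W e i - endpoint n W e (i + 1)
        ≤ 2 * e * max (endpoint n W e (i + 1)) (n / √W) := by
  have hs : 1 ≤ √(W : ℝ) := Real.one_le_sqrt.2 (by exact_mod_cast hW)
  set x : ℝ := n / √W with hx
  have hx0 : 0 ≤ x := by positivity
  rcases lt_trichotomy i (t₁ W e) with h | h | h
  · have h1 : endpoint n W e i = (1 + e) * endpoint n W e (i + 1) := by
      rw [endpoint_of_le h.le, endpoint_of_le h]
      obtain ⟨k, rfl⟩ : ∃ k, i = k + 1 := ⟨i - 1, by omega⟩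
      rw [Nat.add_sub_cancel, Nat.succ_sub_one, pow_succ]
      field_simp
    have h2 : 0 ≤ endpoint n W e (i + 1) := by
      rw [endpoint_of_le h]
      positivity
    have h3 : e * endpoint n W e (i + 1) ≤ e * max (endpoint n W e (i + 1)) x := by
      gcongr
      exact le_max_left _ _
    have h4 : 0 ≤ e * endpoint n W e (i + 1) := by positivity
    rw [h1]
    constructor <;> linarith
  -- At the junction of the two grids the gap runs from at most (1 + e) x down to (1 - e) x; this is
  -- what requires the factor 2 in the gap bound.
  · have h1 : endpoint n W e (i + 1) = x * (1 - e) := by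
      rw [endpoint_of_lt (by omega) (by omega), h]
      push_cast
      ring
    have h2 : x ≤ endpoint n W e i := by
      rw [endpoint_of_le h.le, h, hx]
      have := pow_t₁_le hW he
      gcongr
    have h3 : endpoint n W e i ≤ (1 + e) * x := by
      rw [endpoint_of_le h.le, h, hx, ← mul_div_assoc, div_le_div_iff₀ (by positivity)
        (by positivity)]
      have h4 := (lt_pow_t₁ hW he).le
      rw [← Nat.sub_add_cancel (one_le_t₁ hW he), pow_succ] at h4
      calc (n : ℝ) * √W ≤ n * ((1 + e) ^ (t₁ W e - 1) * (1 + e)) := by gcongr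
        _ = _ := by ring
    have h4 : e * x ≤ e * max (endpoint n W e (i + 1)) x := by
      gcongr
      exact le_max_right _ _
    have h5 : 0 ≤ e * x := by positivity
    rw [h1] at h4 ⊢
    constructor <;> linarith
  · have h1 : endpoint n W e i - endpoint n W e (i + 1) = e * x := by
      rw [endpoint_of_lt h hi.le, endpoint_of_lt (by omega) hi]
      push_cast
      ring
    have h4 : e * x ≤ e * max (endpoint n W e (i + 1)) x := by
      gcongr
      exact le_max_right _ _
    have h5 : 0 ≤ e * x := by positivity
    constructor <;> linarith

/-- More than 1/e - 2 steps of length e n/√W leave less than two of them. -/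
lemma endpoint_last_le (he : 0 < e) (he1 : e ≤ 1 / 102) :
    endpoint n W e (t₁ W e + t₂ e) ≤ 2 * e * (n / √W) := by
  have h2 := one_le_t₂ he he1
  rw [endpoint_of_lt (by omega) le_rfl]
  push_cast
  have h3 : e * (1 / e - 2) ≤ e * t₂ e := by
    gcongr
    exact lt_t₂.le
  have h4 : e * (1 / e - 2) = 1 - 2 * e := by field_simp
  rw [mul_comm (2 * e)]
  gcongr
  linarith

end Endpoints

/-- The relative accuracy of the cost estimate. -/
lemma abs_cost_sub_le {n W : ℕ} [NeZero n] (G : WeightedGraph n W) {T : SimpleGraph (Fin n)}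
    (hT : G.IsMST T) (hn : 2 ≤ n) (hW : 1 ≤ W) (hWn : √(W : ℝ) ≤ n) {ε : ℝ} (hε : 0 < ε)
    (hε1 : ε < 1) {ĉ : ℕ → ℝ} (hĉ : ∀ j, GoodEstimate G (ε / 102 / 8) j (ĉ j)) {J : ℕ → ℕ}
    (hJ : ∀ i, J i = detSearch ĉ (endpoint n W (ε / 102) i) 1 W) :
    |(n : ℝ) * (n - 1) / 2 + 1 / 2 * ∑ i ∈ Icc 1 (t₁ W (ε / 102) + t₂ (ε / 102)),
        ((J (i + 1) : ℝ) - J i) * (endpoint n W (ε / 102) i ^ 2 - endpoint n W (ε / 102) i)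
      - G.slcCost T| ≤ ε * G.slcCost T := by
  set e := ε / 102 with he
  have he0 : 0 < e := by positivity
  have he1 : e ≤ 1 / 102 := by
    rw [he]
    linarith
  have hW0 : (0 : ℝ) < W := by exact_mod_cast hW
  have hs : 0 < √(W : ℝ) := Real.sqrt_pos.2 hW0
  have hss : √(W : ℝ) * √W = W := Real.mul_self_sqrt hW0.le
  have hn2 : (2 : ℝ) ≤ n := by exact_mod_cast hn
  have hWx : W * ((n : ℝ) / √W) = n * √W := by
    rw [mul_div_assoc', div_eq_iff hs.ne', mul_assoc, hss]
    ring
  have hmain := abs_estimate_sub_le (n := n) (W := W) (t := t₁ W e + t₂ e) (e := e)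
    (x := n / √W) (c := fun j => (G.numComponents j : ℝ)) (ĉ := ĉ) (B := endpoint n W e) hn he0
    he1 (by positivity) hW
    (by rw [div_pow, Real.sq_sqrt hW0.le]; field_simp)
    (by rw [hWx, sq]; gcongr)
    (by rw [← hss, sq]; gcongr)
    (fun i j hij => Nat.cast_le.2 (G.numComponents_antitone hij))
    (fun j => by exact_mod_cast G.one_le_numComponents j)
    (fun j => (hĉ j).2.1) (fun j => (hĉ j).2.2)
    (by have := one_le_t₁ hW he0; omega) (endpoint_one hW he0)
    (fun i h1 h2 => (endpoint_succ hW he0 h1 h2).1)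
    (fun i h1 h2 => (endpoint_succ hW he0 h1 h2).2)
    (fun i _ h2 => endpoint_nonneg he0 (by linarith) h2) (endpoint_last_le he0 he1) hJ
  have hcost := hT.slcCost_eq
  rw [Finset.range_eq_Ico, Finset.sum_eq_sum_Ico_succ_bot (by omega),
    G.numComponents_zero] at hcost
  set Z := ∑ j ∈ Ico 1 W, ((G.numComponents j : ℝ) ^ 2 - G.numComponents j) with hZ
  have hZ0 : 0 ≤ Z := Finset.sum_nonneg fun j _ => by
    have : (1 : ℝ) ≤ G.numComponents j := by exact_mod_cast G.one_le_numComponents j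
    nlinarith
  have hεe : ε = 102 * e := by
    rw [he]
    ring
  have hfin : e * (18 * Z + 21 * n ^ 2) / 2 ≤ ε * G.slcCost T := by
    rw [hcost, hεe]
    -- For n ≥ 2 one has n² ≤ 2(n² - n), so the term j = 0 of the cost absorbs the additive error.
    have h1 : (18 * Z + 21 * (n : ℝ) ^ 2) / 2 ≤ 102 * (1 / 2 * ((n : ℝ) ^ 2 - n + Z)) := by
      nlinarith
    calc e * (18 * Z + 21 * n ^ 2) / 2 = e * ((18 * Z + 21 * (n : ℝ) ^ 2) / 2) := by ring
      _ ≤ e * (102 * (1 / 2 * ((n : ℝ) ^ 2 - n + Z))) := by gcongr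
      _ = _ := by
        simp only [hZ]
        ring
  refine le_trans ?_ hfin
  rw [hcost]
  rw [abs_le] at hmain ⊢
  constructor <;> nlinarith [hmain.1, hmain.2]

/-! ### The main algorithm -/

section Main

variable {n W : ℕ} [NeZero n] {G : WeightedGraph n W}

/-- The cost estimate of `appCost`, computed from the results of the binary searches. -/
def costOfIndices (n W : ℕ) (ε : ℝ) (js : List ℕ) : ℝ :=
  (n : ℝ) * (n - 1) / 2 + 1 / 2 * ∑ i ∈ Icc 1 (t₁ W ε + t₂ ε + 1 - 1),
    ((((js.getD (i + 1 - 1) 0 : ℕ) : ℝ)) - ((js.getD (i - 1) 0 : ℕ) : ℝ)) *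
      (endpoint n W ε i ^ 2 - endpoint n W ε i)

omit [NeZero n] in
lemma ev_appCost (adj : Fin n → List (Fin n × ℕ)) (τ C d ε : ℝ) (f : ℝ × List ℕ → ℝ) :
    ev adj τ (appCost C W d ε) f = τ * (3 * (t₁ W ε + t₂ ε + 1 : ℕ) + 1) +
      ev adj τ (searchAll (componentEstimate C W d ε) W
        ((List.range (t₁ W ε + t₂ ε + 1)).map fun i => endpoint n W ε (i + 1)) fun _ => none)
        fun js => f (costOfIndices n W ε js, js) := by
  simp only [appCost, ev_bind, ev_doWork, ev_pure, costOfIndices]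
  push_cast
  rfl

/-- Union bound: fewer than W estimates can be requested, each bad with probability at most 1/(4W).
If none is bad, `abs_cost_sub_le` applies to a fixed good sequence. -/
lemma ev_appCost_failure_le {adj : G.AdjLists} {T : SimpleGraph (Fin n)} (hT : G.IsMST T)
    (hu : ∀ v, 0 < (adj.list v).length) (hn : 2 ≤ n) (hW : 1 ≤ W) (hWn : √(W : ℝ) ≤ n)
    {C ε : ℝ} (hC : 4 ≤ C) (hε : 0 < ε) (hε1 : ε < 1)
    [DecidablePred fun out : ℝ × List ℕ => (1 - ε) * (G.slcCost T : ℝ) ≤ out.1 ∧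
              out.1 ≤ (1 + ε) * (G.slcCost T : ℝ)] :
    ev adj.list 0 (appCost C W G.avgDegree (ε / 102)) (fun out =>
      if (1 - ε) * (G.slcCost T : ℝ) ≤ out.1 ∧ out.1 ≤ (1 + ε) * (G.slcCost T : ℝ)
        then 0 else 1) ≤ 1 / 4 := by
  classical
  have hW0 : (0 : ℝ) < W := by exact_mod_cast hW
  set t := t₁ W (ε / 102) + t₂ (ε / 102) + 1 with ht
  rw [ev_appCost, zero_mul, zero_add]
  have hgood : ∀ m, ∃ x, GoodEstimate G (ε / 102 / 8) m x := by
    intro m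
    refine ⟨G.numComponents m, by exact_mod_cast G.one_le_numComponents m,
      by exact_mod_cast G.numComponents_le m, ?_⟩
    rw [sub_self, abs_zero]
    positivity
  have hsearch := ev_searchAll_le (adj := adj.list)
    (est := componentEstimate C W G.avgDegree (ε / 102)) hgood (δ := 1 / (4 * W))
    (by positivity) (W := W)
    (fun m _ => ev_componentEstimate_le hu hW hC (by positivity))
    ((List.range t).map fun i => endpoint n W (ε / 102) (i + 1)) (T := fun _ => none)
    (fun m x h => by simp at h)
  have hmiss : (missing W (fun _ => none) : ℝ) ≤ W := by
    have : missing W (fun _ => none) ≤ W := by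
      refine (card_filter_le _ _).trans ?_
      rw [Nat.card_Ico]
      omega
    exact_mod_cast this
  refine le_trans (ev_mono _ fun js => ?_) (hsearch.trans ?_)
  · by_cases h : ∃ c, (∀ m, GoodEstimate G (ε / 102 / 8) m (c m)) ∧
        Extends c (fun _ => none) ∧
        js = ((List.range t).map fun i => endpoint n W (ε / 102) (i + 1)).map
          fun B => detSearch c B 1 W
    · rw [if_pos h]
      obtain ⟨c, hc, -, hjs⟩ := h
      have hget : ∀ k < t, js.getD k 0 = detSearch c (endpoint n W (ε / 102) (k + 1)) 1 W := by
        intro k hk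
        rw [hjs, List.getD_eq_getElem _ _ (by simpa using hk)]
        simp
      have hcost := abs_cost_sub_le G hT hn hW hWn hε hε1 hc
        (J := fun i => detSearch c (endpoint n W (ε / 102) i) 1 W) fun i => rfl
      have heq : costOfIndices n W (ε / 102) js
          = (n : ℝ) * (n - 1) / 2 + 1 / 2 * ∑ i ∈ Icc 1 (t₁ W (ε / 102) + t₂ (ε / 102)),
            ((detSearch c (endpoint n W (ε / 102) (i + 1)) 1 W : ℝ)
              - detSearch c (endpoint n W (ε / 102) i) 1 W) *
              (endpoint n W (ε / 102) i ^ 2 - endpoint n W (ε / 102) i) := by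
        rw [costOfIndices, Nat.add_sub_cancel]
        congr 2
        refine Finset.sum_congr rfl fun i hi => ?_
        rw [mem_Icc] at hi
        rw [hget _ (by omega), hget _ (by omega), Nat.add_sub_cancel, Nat.sub_add_cancel hi.1]
      rw [← heq, abs_le] at hcost
      rw [if_pos]
      constructor <;> linarith [hcost.1, hcost.2]
    · rw [if_neg h]
      split_ifs <;> norm_num
  · calc 1 / (4 * (W : ℝ)) * missing W (fun _ => none) ≤ 1 / (4 * W) * W := by gcongr
      _ = 1 / 4 := by field_simp

lemma three_quarters_le_prob_appCost {adj : G.AdjLists} {T : SimpleGraph (Fin n)}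
    (hT : G.IsMST T) (hu : ∀ v, 0 < (adj.list v).length) (hn : 2 ≤ n) (hW : 1 ≤ W)
    (hWn : √(W : ℝ) ≤ n) {C ε : ℝ} (hC : 4 ≤ C) (hε : 0 < ε) (hε1 : ε < 1) :
    3 / 4 ≤ prob adj.list (appCost C W G.avgDegree (ε / 102))
      (fun out => (1 - ε) * (G.slcCost T : ℝ) ≤ out.1 ∧
        out.1 ≤ (1 + ε) * (G.slcCost T : ℝ)) := by
  classical
  rw [prob_eq]
  have h1 := ev_appCost_failure_le hT hu hn hW hWn hC hε hε1
  have h2 : (fun out : ℝ × List ℕ => if (1 - ε) * (G.slcCost T : ℝ) ≤ out.1 ∧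
        out.1 ≤ (1 + ε) * (G.slcCost T : ℝ) then (1 : ℝ) else 0)
      = fun out => -1 * (if (1 - ε) * (G.slcCost T : ℝ) ≤ out.1 ∧
        out.1 ≤ (1 + ε) * (G.slcCost T : ℝ) then 0 else 1) + 1 := by
    funext out
    split_ifs <;> norm_num
  rw [h2, ev_add_const, ev_zero_mul]
  have h3 : (3 / 4 : ENNReal) = ENNReal.ofReal (3 / 4) := by
    rw [ENNReal.ofReal_div_of_pos (by norm_num)]
    norm_num
  rw [h3]
  exact ENNReal.ofReal_le_ofReal (by linarith)

/-- The expected time in terms of the parameters of the algorithm. -/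
lemma ev_appCost_time_le {adj : G.AdjLists} (hu : ∀ v, 0 < (adj.list v).length) {C ε : ℝ}
    {R s : ℕ} (hR : G.avgDegree * (⌈4 * √(W : ℝ) / (ε / 8)⌉₊ : ℝ) ^ 2 < 2 ^ R)
    (hs : W < 2 ^ s) :
    ev adj.list 1 (appCost C W G.avgDegree ε) (fun _ => 0)
      ≤ 3 * (t₁ W ε + t₂ ε + 1) + 1 + (t₁ W ε + t₂ ε + 1) * (1 + s * (1 +
        (⌈C * Real.log (4 * W)⌉₊ * (1 + (1 + ⌈64 * √(W : ℝ) / (ε / 8) ^ 2⌉₊ *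
          (7 + G.avgDegree * (2 + R)))) + ⌈C * Real.log (4 * W)⌉₊ ^ 2 + 2))) := by
  have hd := one_le_avgDegree adj hu
  rw [ev_appCost]
  have h1 : ∀ j, _ := fun j => ev_componentEstimate_time_le (adj := adj) C ε j
    (ev_approxCC_time_le hu j (ε / 8) (√W) hR)
  have h2 := ev_searchAll_time_le (adj := adj.list) h1 (by positivity) (W := W) (s := s)
    (by omega) ((List.range (t₁ W ε + t₂ ε + 1)).map fun i => endpoint n W ε (i + 1))
    fun _ => none
  rw [List.length_map, List.length_range] at h2
  push_cast at h2 ⊢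
  linarith

end Main

/-! ### The running time in terms of the input parameters -/

section Bounds

variable {W : ℕ} {d ε : ℝ}

/-- The factor 2 keeps the logarithm above 1/2, so that additive constants can be absorbed even when
W d / ε is close to 1. -/
lemma log_two_mul_bounds (hW : 1 ≤ W) (hd : 1 ≤ d) (hε : 0 < ε) (hε1 : ε < 1) :
    1 ≤ 2 * Real.log (2 * (W * d / ε)) ∧ Real.log W ≤ Real.log (2 * (W * d / ε)) ∧
      Real.log (4 * W) ≤ 3 * Real.log (2 * (W * d / ε)) ∧
      Real.log (W * d / ε) ≤ Real.log (2 * (W * d / ε)) := by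
  have hW' : (1 : ℝ) ≤ W := by exact_mod_cast hW
  have h1 : (W : ℝ) ≤ W * d / ε := by
    rw [le_div_iff₀ hε]
    gcongr
    linarith
  have hY : 1 ≤ W * d / ε := hW'.trans h1
  have hlog2 := Real.log_two_gt_d9
  have h2 : Real.log (2 * (W * d / ε)) = Real.log 2 + Real.log (W * d / ε) :=
    Real.log_mul (by norm_num) (by linarith)
  have h3 : Real.log W ≤ Real.log (W * d / ε) := Real.log_le_log (by linarith) h1
  have h4 : 0 ≤ Real.log (W * d / ε) := Real.log_nonneg hY
  have h5 : Real.log (4 * W) = 2 * Real.log 2 + Real.log W := by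
    rw [Real.log_mul (by norm_num) (by linarith), show (4 : ℝ) = 2 ^ 2 by norm_num, Real.log_pow]
    norm_num
  refine ⟨?_, ?_, ?_, ?_⟩ <;> linarith

/-- The same q later bounds the depth of the binary searches and, as 24 + 2q, the number of
doublings of a graph search. -/
lemma exists_pow_two_gt {Y : ℝ} (hY : 1 ≤ Y) :
    ∃ q : ℕ, Y < 2 ^ q ∧ (q : ℝ) ≤ 2 * Real.log Y + 1 := by
  have h0 : 0 ≤ Real.logb 2 Y := Real.logb_nonneg (by norm_num) hY
  refine ⟨⌊Real.logb 2 Y⌋₊ + 1, ?_, ?_⟩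
  · rw [← Real.rpow_natCast, ← Real.logb_lt_iff_lt_rpow (by norm_num) (by linarith)]
    push_cast
    exact Nat.lt_floor_add_one _
  · have h1 := Nat.floor_le h0
    have h2 : Real.logb 2 Y ≤ 2 * Real.log Y := by
      rw [Real.logb, div_le_iff₀ (Real.log_pos (by norm_num))]
      have := Real.log_two_gt_d9
      nlinarith [Real.log_nonneg hY]
    push_cast
    linarith

/-- From log(1 + e) ≥ e/2, the geometric part has O(log W / e) endpoints, and the arithmetic part
O(1/e). The constant is 102 + 204 + 2. -/
lemma number_of_endpoints_le (hW : 1 ≤ W) (hε : 0 < ε) (hε1 : ε < 1) {L : ℝ} (hL : 1 ≤ 2 * L)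
    (hWL : Real.log W ≤ L) :
    (t₁ W (ε / 102) + t₂ (ε / 102) + 1 : ℝ) ≤ 308 * (L / ε) := by
  have hW' : (1 : ℝ) ≤ W := by exact_mod_cast hW
  have hs : 1 ≤ √(W : ℝ) := Real.one_le_sqrt.2 hW'
  have h2 : (t₂ (ε / 102) : ℝ) ≤ 102 / ε - 1 := by
    rw [← one_div_div ε 102]
    exact t₂_le (by positivity) (by linarith)
  have h1 : (t₁ W (ε / 102) : ℝ) ≤ 102 * (L / ε) + 1 := by
    have h0 := Real.logb_nonneg (b := 1 + ε / 102) (by linarith) hs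
    refine (Nat.floor_le (by linarith)).trans ?_
    have h3 : ε / 102 / 2 ≤ Real.log (1 + ε / 102) := by
      have h4 := Real.le_log_one_add_of_nonneg (x := ε / 102) (by positivity)
      refine le_trans ?_ h4
      rw [div_le_div_iff₀ (by norm_num) (by positivity)]
      nlinarith
    have h5 : Real.log √(W : ℝ) = Real.log W / 2 := Real.log_sqrt (by linarith)
    rw [Real.logb, h5]
    have h6 : Real.log W / 2 / Real.log (1 + ε / 102) ≤ L / 2 / (ε / 102 / 2) := by
      gcongr
      linarith
    have h7 : L / 2 / (ε / 102 / 2) = 102 * (L / ε) := by field_simp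
    linarith
  have h3 : 102 / ε ≤ 204 * (L / ε) := by
    rw [mul_div_assoc', div_le_div_iff_of_pos_right hε]
    linarith
  have h4 : 1 ≤ L / ε * 2 := by
    rw [div_mul_eq_mul_div, le_div_iff₀ hε]
    linarith
  linarith

/-- Γ is at most 3264 √W/ε + 1 ≤ 3265 √W/ε, and 3265 < 2 ^ 12; squaring gives the 24, and W d/ε² ≤
(W d/ε)² gives the 2q. -/
lemma threshold_sq_lt (hW : 1 ≤ W) (hd : 1 ≤ d) (hε : 0 < ε) (hε1 : ε < 1) {q : ℕ}
    (hq : W * d / ε < 2 ^ q) :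
    d * (⌈4 * √(W : ℝ) / (ε / 102 / 8)⌉₊ : ℝ) ^ 2 < 2 ^ (24 + 2 * q) := by
  have hW' : (1 : ℝ) ≤ W := by exact_mod_cast hW
  have hs : 1 ≤ √(W : ℝ) := Real.one_le_sqrt.2 hW'
  have hsε : 1 ≤ √(W : ℝ) / ε := by
    rw [le_div_iff₀ hε]
    linarith
  have h1 : (⌈4 * √(W : ℝ) / (ε / 102 / 8)⌉₊ : ℝ) ≤ 3265 * (√W / ε) := by
    have h2 := (Nat.ceil_lt_add_one (a := 4 * √(W : ℝ) / (ε / 102 / 8)) (by positivity)).le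
    have h3 : 4 * √(W : ℝ) / (ε / 102 / 8) = 3264 * (√W / ε) := by
      field_simp
      norm_num
    linarith
  have hY : 0 ≤ W * d / ε := by positivity
  calc d * (⌈4 * √(W : ℝ) / (ε / 102 / 8)⌉₊ : ℝ) ^ 2 ≤ d * (3265 * (√W / ε)) ^ 2 := by gcongr
    _ = 3265 ^ 2 * (W * d / ε ^ 2) := by
      rw [mul_pow, div_pow, Real.sq_sqrt (by linarith)]
      ring
    _ ≤ 3265 ^ 2 * (W * d / ε) ^ 2 := by
      rw [div_pow]
      gcongr
      have : 1 ≤ W * d := one_le_mul_of_one_le_of_one_le hW' hd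
      nlinarith
    _ < 4096 ^ 2 * (2 ^ q) ^ 2 := by
      have h2 : (W * d / ε) ^ 2 < (2 ^ q) ^ 2 := by gcongr
      nlinarith [sq_nonneg (W * d / ε)]
    _ = 2 ^ (24 + 2 * q) := by
      rw [pow_add, pow_mul']
      norm_num

lemma number_of_samples_le (hW : 1 ≤ W) (hε : 0 < ε) (hε1 : ε < 1) :
    (⌈64 * √(W : ℝ) / (ε / 102 / 8) ^ 2⌉₊ : ℝ) ≤ 42614785 * (√W / ε ^ 2) := by
  have hW' : (1 : ℝ) ≤ W := by exact_mod_cast hW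
  have hs : 1 ≤ √(W : ℝ) := Real.one_le_sqrt.2 hW'
  have h1 : 1 ≤ √(W : ℝ) / ε ^ 2 := by
    rw [le_div_iff₀ (by positivity)]
    nlinarith
  have h2 := (Nat.ceil_lt_add_one (a := 64 * √(W : ℝ) / (ε / 102 / 8) ^ 2) (by positivity)).le
  have h3 : 64 * √(W : ℝ) / (ε / 102 / 8) ^ 2 = 42614784 * (√W / ε ^ 2) := by
    field_simp
    norm_num
  linarith

/-- The elementary estimate behind the bound on the running time. -/
lemma time_le_of_bounds {L Q M A t m r R s d u v : ℝ} (hL : 1 ≤ 2 * L) (hd : 1 ≤ d)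
    (hu1 : 1 ≤ u) (hQ : Q = u * d) (ht1 : 1 ≤ t) (ht : t ≤ 308 * v)
    (hm0 : 0 ≤ m) (hm : m ≤ M * L) (hr0 : 0 ≤ r) (hr : r ≤ A * u) (hR0 : 0 ≤ R)
    (hR : R ≤ 56 * L) (hs0 : 0 ≤ s) (hs : s ≤ 4 * L) (hM : 0 ≤ M) (hA : 0 ≤ A) :
    3 * t + 1 + t * (1 + s * (1 + (m * (1 + (1 + r * (7 + d * (2 + R)))) + m ^ 2 + 2)))
      ≤ 308 * (60 + 4 * (M * (4 + 74 * A) + M ^ 2 + 8)) * (v * Q * L ^ 3) := by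
  have hL0 : 0 < L := by linarith
  have hu0 : 0 < u := by linarith
  have hQ1 : 1 ≤ Q := by
    rw [hQ]
    exact one_le_mul_of_one_le_of_one_le hu1 hd
  have hQ0 : 0 < Q := by linarith
  have hv0 : 0 ≤ v := by linarith
  -- The doublings R, the repetitions m and the search depth s each contribute one factor L; in the
  -- application v = L/ε brings the fourth. Constants are absorbed through 1 ≤ 2L.
  have hLL : 1 ≤ 4 * L ^ 2 := by nlinarith
  have hLLL : 1 ≤ 8 * L ^ 3 := by nlinarith
  have h1 : 7 + d * (2 + R) ≤ 74 * (d * L) := by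
    have h2 : d * (2 + R) ≤ d * (60 * L) := by
      gcongr
      linarith
    have h3 : 7 ≤ 14 * (d * L) := by nlinarith
    linarith
  have h2 : 1 + (1 + r * (7 + d * (2 + R))) ≤ (4 + 74 * A) * (Q * L) := by
    have h3 : r * (7 + d * (2 + R)) ≤ A * u * (74 * (d * L)) := by gcongr
    have h4 : A * u * (74 * (d * L)) = 74 * A * (Q * L) := by
      rw [hQ]
      ring
    have h5 : 1 ≤ 2 * (Q * L) := by nlinarith
    linarith
  have h3 : 1 + (m * (1 + (1 + r * (7 + d * (2 + R)))) + m ^ 2 + 2)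
      ≤ (M * (4 + 74 * A) + M ^ 2 + 12) * (Q * L ^ 2) := by
    have h4 : m * (1 + (1 + r * (7 + d * (2 + R)))) ≤ M * L * ((4 + 74 * A) * (Q * L)) := by
      gcongr
    have h5 : m ^ 2 ≤ (M * L) ^ 2 := by gcongr
    have h6 : (M * L) ^ 2 ≤ M ^ 2 * (Q * L ^ 2) := by
      rw [mul_pow]
      gcongr
      exact le_mul_of_one_le_left (by positivity) hQ1
    have h7 : 1 ≤ 4 * (Q * L ^ 2) := by nlinarith
    linarith
  set A₂ := M * (4 + 74 * A) + M ^ 2 + 12 with hA₂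
  have hA₂0 : 0 ≤ A₂ := by positivity
  have h4 : 4 + s * (1 + (m * (1 + (1 + r * (7 + d * (2 + R)))) + m ^ 2 + 2))
      ≤ (32 + 4 * A₂) * (Q * L ^ 3) := by
    have h5 : s * (1 + (m * (1 + (1 + r * (7 + d * (2 + R)))) + m ^ 2 + 2))
        ≤ 4 * L * (A₂ * (Q * L ^ 2)) := by gcongr
    have h6 : 4 ≤ 32 * (Q * L ^ 3) := by nlinarith
    linarith
  calc 3 * t + 1 + t * (1 + s * (1 + (m * (1 + (1 + r * (7 + d * (2 + R)))) + m ^ 2 + 2)))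
      ≤ t * (4 + s * (1 + (m * (1 + (1 + r * (7 + d * (2 + R)))) + m ^ 2 + 2))) + 1 := by
        linarith
    _ ≤ 308 * v * ((32 + 4 * A₂) * (Q * L ^ 3)) + 308 * v * (8 * (Q * L ^ 3)) := by
        have h5 : 1 ≤ 308 * v * (8 * (Q * L ^ 3)) := by
          have h6 : 1 ≤ 308 * v := ht1.trans ht
          have h7 : 1 ≤ 8 * (Q * L ^ 3) := by nlinarith
          exact one_le_mul_of_one_le_of_one_le h6 h7
        gcongr
    _ ≤ _ := by
        rw [hA₂]
        have : 0 ≤ v * Q * L ^ 3 := by positivity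
        nlinarith

end Bounds

lemma expectedTime_appCost_le {C : ℝ} (hC : 4 ≤ C) {n W : ℕ} [NeZero n]
    {G : WeightedGraph n W} (adj : G.AdjLists) (hu : ∀ v, 0 < (adj.list v).length)
    (hW : 1 ≤ W) {ε : ℝ} (hε : 0 < ε) (hε1 : ε < 1) :
    expectedTime adj.list (appCost C W G.avgDegree (ε / 102)) ≤
      ENNReal.ofReal (308 * (60 + 4 * ((3 * C + 2) * (4 + 74 * 42614785) + (3 * C + 2) ^ 2 + 8))
        * (√(W : ℝ) * G.avgDegree / ε ^ 3 * Real.log (2 * (W * G.avgDegree / ε)) ^ 4)) := by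
  rw [expectedTime_eq]
  apply ENNReal.ofReal_le_ofReal
  have hd := one_le_avgDegree adj hu
  have hW' : (1 : ℝ) ≤ W := by exact_mod_cast hW
  have hs : 1 ≤ √(W : ℝ) := Real.one_le_sqrt.2 hW'
  obtain ⟨hL, hWL, h4WL, hYL⟩ := log_two_mul_bounds hW hd hε hε1
  set L := Real.log (2 * (W * G.avgDegree / ε)) with hLdef
  have hWY : (W : ℝ) ≤ W * G.avgDegree / ε := by
    rw [le_div_iff₀ hε]
    gcongr
    linarith
  obtain ⟨q, hq, hqL⟩ := exists_pow_two_gt (hW'.trans hWY)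
  have hWq : W < 2 ^ q := by
    have : (W : ℝ) < 2 ^ q := hWY.trans_lt hq
    exact_mod_cast this
  refine (ev_appCost_time_le hu (threshold_sq_lt hW hd hε hε1 hq) hWq).trans ?_
  have hlog4 : 0 ≤ Real.log (4 * W) := Real.log_nonneg (by linarith)
  have hm : (⌈C * Real.log (4 * W)⌉₊ : ℝ) ≤ (3 * C + 2) * L := by
    have h1 := (Nat.ceil_lt_add_one (a := C * Real.log (4 * W)) (by positivity)).le
    have h2 : C * Real.log (4 * W) ≤ C * (3 * L) := by gcongr
    linarith
  have hu1 : 1 ≤ √(W : ℝ) / ε ^ 2 := by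
    rw [le_div_iff₀ (by positivity)]
    nlinarith
  refine (time_le_of_bounds (L := L) (Q := √W / ε ^ 2 * G.avgDegree) (u := √W / ε ^ 2)
    (v := L / ε) (M := 3 * C + 2) (A := 42614785) hL hd hu1 rfl ?_
    (number_of_endpoints_le hW hε hε1 hL hWL) (by positivity) hm (by positivity)
    (number_of_samples_le hW hε hε1) (by positivity) ?_ (by positivity) (by linarith)
    (by positivity) (by norm_num)).trans (le_of_eq ?_)
  · have h1 : (0 : ℝ) ≤ t₁ W (ε / 102) := by positivity
    have h2 : (0 : ℝ) ≤ t₂ (ε / 102) := by positivity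
    linarith
  -- Here R = 24 + 2q ≤ 26 + 4L ≤ 56 L, by q ≤ 2L + 1 and 1 ≤ 2L.
  · push_cast
    linarith
  · field_simp

end SLC

end

theorem mainTheorem1 :
    ∃ C₀ : ℝ, 0 < C₀ ∧ ∀ C : ℝ, C₀ ≤ C → ∃ K : ℝ, 0 < K ∧
      ∀ (n W : ℕ) [NeZero n] (G : SLC.WeightedGraph n W) (adj : G.AdjLists) (ε : ℝ),
        2 ≤ n → G.graph.Connected → √(W : ℝ) ≤ n → 0 < ε → ε < 1 →
        (∀ T : SimpleGraph (Fin n), G.IsMST T →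
          3 / 4 ≤ SLC.Prog.prob adj.list (SLC.appCost C W G.avgDegree (ε / 102))
            (fun out => (1 - ε) * (G.slcCost T : ℝ) ≤ out.1 ∧
              out.1 ≤ (1 + ε) * (G.slcCost T : ℝ))) ∧
        SLC.Prog.expectedQueries adj.list (SLC.appCost C W G.avgDegree (ε / 102)) ≤
          ENNReal.ofReal (K * (√(W : ℝ) * G.avgDegree / ε ^ 3 *
            Real.log (2 * (W * G.avgDegree / ε)) ^ 4)) ∧
        SLC.Prog.expectedTime adj.list (SLC.appCost C W G.avgDegree (ε / 102)) ≤
          ENNReal.ofReal (K * (√(W : ℝ) * G.avgDegree / ε ^ 3 *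
            Real.log (2 * (W * G.avgDegree / ε)) ^ 4)) := by
  refine ⟨4, by norm_num, fun C hC =>
    ⟨308 * (60 + 4 * ((3 * C + 2) * (4 + 74 * 42614785) + (3 * C + 2) ^ 2 + 8)), ?_,
      fun n W _ G adj ε hn hG hWn hε hε1 => ?_⟩⟩
  · have : 0 ≤ C := by linarith
    positivity
  · have hu := SLC.length_pos_of_connected adj hn hG
    -- A connected graph on at least two vertices has an edge, and its weight lies between 1 and W.
    have hW : 1 ≤ W := by
      obtain ⟨⟨u, a⟩, hmem⟩ := List.exists_mem_of_length_pos (hu 0)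
      have hadj := ((adj.mem_iff _ _ _).1 hmem).1
      exact (G.one_le_weight s(0, u) hadj).trans (G.weight_le s(0, u) hadj)
    have htime := SLC.expectedTime_appCost_le hC adj hu hW hε hε1
    exact ⟨fun T hT => SLC.three_quarters_le_prob_appCost hT hu hn hW hWn hC hε hε1,
      (SLC.Prog.expectedQueries_le_expectedTime _).trans htime, htime⟩
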